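/- Let $R$ be a commutative $\mathbb{Q}$-algebra (the ring of coefficients, possibly containing parameters). Let $\mathcal F$ be the fermionic Fock space, with orthonormal basis the wedges $\underline{A}=\underline{a_1}\wedge\underline{a_2}\wedge\cdots$ of admissible sets $A=\{a_1>a_2>\cdots\}\subset\mathbb{Z}+\frac12$ (finitely many positive elements, finitely many missing negative half-integers) and vacuum $|0\rangle=\underline{-\tfrac12}\wedge\underline{-\tfrac32}\wedge\cdots$. The operators $\psi_r,\psi_r^*$ ($r\in\mathbb{Z}+\frac12$) are given by $$\psi_r\underline{A}=(-1)^{\#\{a\in A:\,a>r\}}\,\underline{A\cup\{r\}}\ \text{ if } r\notin A,\qquad \psi_r^*\underline{A}=(-1)^{\#\{a\in A:\,a>r\}}\,\underline{A\setminus\{r\}}\ \text{ if } r\in A,$$ and are $0$ on the other basis vectors. On $\mathcal F_1\otimes\cdots\otimes\mathcal F_N$ (copies of $\mathcal F$, completed so as to contain infinite formal linear combinations of the basis vectors) $\psi^i_r,\psi^{i*}_r$ act on the $i$-th factor with the Koszul signs, so that operators belonging to different factors anticommute. A vector is a *Bogoliubov transform* over a coefficient ring $S$ if it has the form $$\exp\Big(\sum_{i,j}\sum_{m,n\ge0}A^{ij}_{mn}\,\psi^i_{m+1/2}\psi^{j*}_{-(n+1/2)}\Big)|0\rangle,\qquad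 A^{ij}_{mn}\in S .$$ Let $M>0$ and let $$V=\exp\Big(\sum_{i,j\in\{1,\dots,M,a,b\}}\sum_{m,n\ge0}A^{ij}_{mn}\psi^i_{m+1/2}\psi^{j*}_{-(n+1/2)}\Big)|0\rangle,\qquad A^{ij}_{mn}\in R,$$ be an arbitrary Bogoliubov transform in $\mathcal F_1\otimes\cdots\otimes\mathcal F_M\otimes\mathcal F_a\otimes\mathcal F_b$. For arbitrary $E^{ij}_{mn}\in R$ ($i,j\in\{a,b\}$, $m,n\ge0$) let $$P^{\mathbf E}_{ab}=\exp\Big(\sum_{i,j\in\{a,b\}}\sum_{m,n\ge0}Q^{m+n+1}\Theta^{\epsilon_{ij}}E^{ij}_{mn}\psi^i_{m+1/2}\psi^{j*}_{-(n+1/2)}\Big)|0\rangle_{ab},$$ where $Q,\Theta$ are formal variables, $\epsilon_{ab}=1$, $\epsilon_{ba}=-1$ and $\epsilon_{aa}=\epsilon_{bb}=0$. Let $\tilde G^{\mathbf E}(V)=(V,P^{\mathbf E}_{ab})$ be the inner product over $\mathcal F_a\otimes\mathcal F_b$ (bilinear, with the standard basis orthonormal), and let $$\tilde G^{\mathbf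 E}(V)_{closed}=\Big(\exp\Big(\sum_{i,j\in\{a,b\}}\sum_{m,n\ge0}A^{ij}_{mn}\psi^i_{m+1/2}\psi^{j*}_{-(n+1/2)}\Big)|0\rangle_{ab},\;P^{\mathbf E}_{ab}\Big).$$ Then both inner products are well defined as formal series: in each coefficient with respect to the basis of $\mathcal F_1\otimes\cdots\otimes\mathcal F_M$, every power of $Q$ receives only finitely many contributions, and the result lies in $R[\Theta,\Theta^{-1}][[Q]]$. The closed part $\tilde G^{\mathbf E}(V)_{closed}$ is invertible in $R[\Theta,\Theta^{-1}][[Q]]$, and the normalized self-gluing $$G^{\mathbf E}(V)=\tilde G^{\mathbf E}(V)/\tilde G^{\mathbf E}(V)_{closed}$$ is again a Bogoliubov transform in $\mathcal F_1\otimes\cdots\otimes\mathcal F_M$, i.e. there are $R^{ij}_{mn}\in R[\Theta,\Theta^{-1}][[Q]]$ with $$G^{\mathbf E}(V)=\exp\Big(\sum_{i,j=1}^M\sum_{m,n\ge0}R^{ij}_{mn}\psi^i_{m+1/2}\psi^{j*}_{-(n+1/2)}\Big)|0\rangle .$$ -/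

import Mathlib

noncomputable section

namespace FermionicGluing

/-- An admissible set `A ⊆ ℤ + 1/2`. The half-integer `k + 1/2` is encoded by the integer `k`, so
the negative half-integers correspond to `k < 0`: only finitely many negative half-integers are
missing from `A` and only finitely many positive ones belong to `A`. -/
def Maya : Type :=
  {A : Set ℤ // {k : ℤ | k < 0 ∧ k ∉ A}.Finite ∧ {k : ℤ | 0 ≤ k ∧ k ∈ A}.Finite}

namespace Maya

/-- The set of negative half-integers; its wedge is the fermionic vacuum of one component. -/
def vacuum : Maya :=
  ⟨{k | k < 0},
    Set.finite_empty.subset fun _ hk => hk.2 hk.1,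
    Set.finite_empty.subset fun _ hk => absurd hk.2 (not_lt.mpr hk.1)⟩

/-- `A ∪ {r}`. -/
def insert (r : ℤ) (A : Maya) : Maya :=
  ⟨Insert.insert r A.1,
    A.2.1.subset fun _ hk => ⟨hk.1, fun h => hk.2 (Or.inr h)⟩,
    (A.2.2.insert r).subset fun _ hk => hk.2.imp id fun h => ⟨hk.1, h⟩⟩

/-- `A \ {r}`. -/
def erase (r : ℤ) (A : Maya) : Maya :=
  ⟨A.1 \ {r},
    (A.2.1.insert r).subset fun k hk => by
      by_cases h : k = r
      · exact Or.inl h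
      · exact Or.inr ⟨hk.1, fun hA => hk.2 ⟨hA, h⟩⟩,
    A.2.2.subset fun _ hk => ⟨hk.1, hk.2.1⟩⟩

/-- The number of positive half-integers in `A`. -/
def particles (A : Maya) : ℕ := {k : ℤ | 0 ≤ k ∧ k ∈ A.1}.ncard

/-- The number of negative half-integers that are not in `A`. -/
def holes (A : Maya) : ℕ := {k : ℤ | k < 0 ∧ k ∉ A.1}.ncard

/-- The charge of the basis vector of `A`. -/
def charge (A : Maya) : ℤ := (A.particles : ℤ) - (A.holes : ℤ)

/-- The number of elements of `A` that are greater than `r`; this set is always finite. -/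
def above (r : ℤ) (A : Maya) : ℕ := {k : ℤ | r < k ∧ k ∈ A.1}.ncard

end Maya

/-- The completed `N`-component fermionic Fock space over `R`: formal, possibly infinite, linear
combinations of the basis vectors `A₁ ⊗ ⋯ ⊗ A_N`, where each `A_i` is (the wedge of) an admissible
set. A vector is given by its coefficients in this basis. -/
abbrev Fock (N : ℕ) (R : Type*) : Type _ := (Fin N → Maya) → R

variable {N : ℕ} {R : Type*} [CommRing R]

/-- The vacuum `|0⟩ ⊗ ⋯ ⊗ |0⟩`. -/
def vac (N : ℕ) (R : Type*) [CommRing R] : Fock N R := by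
  classical exact Pi.single (fun _ => Maya.vacuum) 1

/-- The sign of `ψ^i_r` and `ψ^{i*}_r` on the basis vector `A`: the sign `(-1)^#{a ∈ A_i : a > r}`
of the one-component operator, times the Koszul sign `(-1)^{charge}` of the factors to the left
of the `i`-th one. -/
def sign (i : Fin N) (r : ℤ) (A : Fin N → Maya) : ℤˣ :=
  Int.negOnePow ((∑ j ∈ Finset.univ.filter (· < i), (A j).charge) + ((A i).above r : ℤ))

open Classical in
/-- The operator `ψ^i_r` (with `r` standing for `r + 1/2`), which maps a basis vector `A` with
`r ∉ A_i` to `sign i r A` times the basis vector with `A_i` replaced by `A_i ∪ {r}`, and the other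
basis vectors to `0`. Hence the coefficient of `ψ^i_r f` at `B` comes from that of `f` at
`B_i \ {r}`. -/
def psi (i : Fin N) (r : ℤ) : Fock N R →ₗ[R] Fock N R where
  toFun f B := if r ∈ (B i).1 then
    sign i r B • f (Function.update B i ((B i).erase r)) else 0
  map_add' f g := by
    funext B
    by_cases h : r ∈ (B i).1 <;> simp [h]
  map_smul' c f := by
    funext B
    by_cases h : r ∈ (B i).1 <;> simp [h, Units.smul_def, mul_left_comm]

open Classical in
/-- The operator `ψ^{i*}_r` (with `r` standing for `r + 1/2`), which maps a basis vector `A` with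
`r ∈ A_i` to `sign i r A` times the basis vector with `A_i` replaced by `A_i \ {r}`, and the other
basis vectors to `0`. -/
def psiStar (i : Fin N) (r : ℤ) : Fock N R →ₗ[R] Fock N R where
  toFun f B := if r ∈ (B i).1 then 0 else
    sign i r B • f (Function.update B i ((B i).insert r))
  map_add' f g := by
    funext B
    by_cases h : r ∈ (B i).1 <;> simp [h]
  map_smul' c f := by
    funext B
    by_cases h : r ∈ (B i).1 <;> simp [h, Units.smul_def, mul_left_comm]

/-- Coefficients `A^{ij}_{mn}` of a quadratic expression in the fermionic creators. -/
abbrev Coeffs (N : ℕ) (R : Type*) : Type _ := Fin N → Fin N → ℕ → ℕ → R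

/-- The quadratic creator `ψ^i_{m+1/2} ψ^{j*}_{-(n+1/2)}`. -/
def pair (i j : Fin N) (m n : ℕ) : Fock N R →ₗ[R] Fock N R :=
  psi i (m : ℤ) ∘ₗ psiStar j (-(n : ℤ) - 1)

theorem pair_apply_ne_zero {i j : Fin N} {m n : ℕ} {f : Fock N R} {B : Fin N → Maya}
    (h : pair i j m n f B ≠ 0) : (m : ℤ) ∈ (B i).1 ∧ (-(n : ℤ) - 1) ∉ (B j).1 := by
  simp only [pair, LinearMap.comp_apply, psi, psiStar, LinearMap.coe_mk, AddHom.coe_mk] at h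
  split_ifs at h with h1 h2
  · simp at h
  · refine ⟨h1, fun h3 => h2 ?_⟩
    by_cases hij : j = i
    · subst hij
      have h4 : (-(n : ℤ) - 1) ∈ ((B j).erase (m : ℤ)).1 := ⟨h3, by simp; omega⟩
      simpa using h4
    · simpa [Function.update_of_ne hij] using h3
  · simp at h

/-- At every basis vector only finitely many terms of a quadratic expression contribute. -/
theorem pair_support_finite (i j : Fin N) (a : ℕ → ℕ → R) (f : Fock N R) (B : Fin N → Maya) :
    (Function.support fun p : ℕ × ℕ => a p.1 p.2 * pair i j p.1 p.2 f B).Finite := by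
  have h1 : {m : ℕ | (m : ℤ) ∈ (B i).1}.Finite :=
    ((B i).2.2.preimage (f := fun m : ℕ => (m : ℤ)) Nat.cast_injective.injOn).subset
      fun m hm => ⟨Int.natCast_nonneg m, hm⟩
  have h2 : {n : ℕ | (-(n : ℤ) - 1) ∉ (B j).1}.Finite :=
    ((B j).2.1.preimage (f := fun n : ℕ => -(n : ℤ) - 1)
      (fun x _ y _ h => by simp at h; exact h)).subset
      fun n hn => ⟨show -(n : ℤ) - 1 < 0 by omega, hn⟩
  refine (h1.prod h2).subset fun p hp => ?_
  exact pair_apply_ne_zero (right_ne_zero_of_mul hp)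

/-- The operator `∑_{i,j} ∑_{m,n ≥ 0} A^{ij}_{mn} ψ^i_{m+1/2} ψ^{j*}_{-(n+1/2)}`. -/
def quad (A : Coeffs N R) : Fock N R →ₗ[R] Fock N R where
  toFun f B := ∑ i, ∑ j, ∑ᶠ p : ℕ × ℕ, A i j p.1 p.2 * pair i j p.1 p.2 f B
  map_add' f g := by
    funext B
    simp only [Pi.add_apply, ← Finset.sum_add_distrib]
    refine Finset.sum_congr rfl fun i _ => Finset.sum_congr rfl fun j _ => ?_
    rw [← finsum_add_distrib (pair_support_finite i j (A i j) f B)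
      (pair_support_finite i j (A i j) g B)]
    simp only [map_add, Pi.add_apply, mul_add]
  map_smul' c f := by
    funext B
    simp only [Pi.smul_apply, smul_eq_mul, RingHom.id_apply, Finset.mul_sum]
    refine Finset.sum_congr rfl fun i _ => Finset.sum_congr rfl fun j _ => ?_
    rw [mul_finsum' _ _ (pair_support_finite i j (A i j) f B)]
    simp only [map_smul, Pi.smul_apply, smul_eq_mul, mul_left_comm]

/-- The `k`-th power of a quadratic expression in the creators produces at least `k` particles. -/
theorem quad_pow_eq_zero (A : Coeffs N R) (f : Fock N R) (k : ℕ) (B : Fin N → Maya)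
    (h : ∑ i, (B i).particles < k) : ((quad A) ^ k) f B = 0 := by
  induction k generalizing B with
  | zero => omega
  | succ k ih =>
    rw [pow_succ', Module.End.mul_apply]
    change ∑ i, ∑ j, ∑ᶠ p : ℕ × ℕ, A i j p.1 p.2 * pair i j p.1 p.2 (((quad A) ^ k) f) B = 0
    refine Finset.sum_eq_zero fun i _ => Finset.sum_eq_zero fun j _ => ?_
    refine finsum_eq_zero_of_forall_eq_zero fun p => ?_
    by_contra hne
    have hm := (pair_apply_ne_zero (right_ne_zero_of_mul hne)).1
    apply right_ne_zero_of_mul hne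
    simp only [pair, LinearMap.comp_apply, psi, psiStar, LinearMap.coe_mk, AddHom.coe_mk, if_pos hm]
    split_ifs with h2
    · simp
    · rw [ih, smul_zero, smul_zero]
      set C := Function.update B i ((B i).erase (p.1 : ℤ)) with hC
      have e1 : ∀ l, (Function.update C j ((C j).insert (-(p.2 : ℤ) - 1)) l).particles
          = (C l).particles := by
        intro l
        by_cases hl : l = j
        · subst hl
          rw [Function.update_self]
          refine congrArg Set.ncard (Set.ext fun x => ⟨?_, ?_⟩)
          · rintro ⟨h0, rfl | hx⟩
            · omega
            · exact ⟨h0, hx⟩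
          · rintro ⟨h0, hx⟩
            exact ⟨h0, Or.inr hx⟩
        · rw [Function.update_of_ne hl]
      have e2 : ((B i).erase (p.1 : ℤ)).particles < (B i).particles := by
        refine Set.ncard_lt_ncard ?_ (B i).2.2
        refine ⟨fun x hx => ⟨hx.1, hx.2.1⟩, fun hsub => ?_⟩
        have := hsub (show (p.1 : ℤ) ∈ {k : ℤ | 0 ≤ k ∧ k ∈ (B i).1} from
          ⟨Int.natCast_nonneg _, hm⟩)
        exact this.2.2 rfl
      have e3 : ∑ l, (C l).particles < ∑ l, (B l).particles := by
        refine Finset.sum_lt_sum (fun l _ => ?_) ⟨i, Finset.mem_univ _, ?_⟩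
        · by_cases hl : l = i
          · subst hl
            simpa [hC] using e2.le
          · simp [hC, Function.update_of_ne hl]
        · simpa [hC] using e2
      rw [Finset.sum_congr rfl fun l _ => e1 l]
      omega

section Exp

variable [Algebra ℚ R]

/-- `exp (∑ A^{ij}_{mn} ψ^i_{m+1/2} ψ^{j*}_{-(n+1/2)})` applied to `f`, by the exponential series
`∑_k X^k f / k!`, computed coefficientwise. -/
def expQuad (A : Coeffs N R) (f : Fock N R) : Fock N R :=
  fun B => ∑ᶠ k : ℕ, ((k.factorial : ℚ)⁻¹) • ((quad A) ^ k) f B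

/-- The exponential series is a finite sum at every basis vector. -/
theorem expQuad_support_finite (A : Coeffs N R) (f : Fock N R) (B : Fin N → Maya) :
    (Function.support fun k : ℕ => ((k.factorial : ℚ)⁻¹) • ((quad A) ^ k) f B).Finite := by
  refine (Set.finite_le_nat (∑ i, (B i).particles)).subset fun k hk => ?_
  by_contra hlt
  exact hk (by simp only [quad_pow_eq_zero A f k B (not_le.mp hlt), smul_zero])

/-- The Bogoliubov transform of the vacuum with coefficients `A`. -/
def bogoliubov (A : Coeffs N R) : Fock N R := expQuad A (vac N R)

/-- `v` is a Bogoliubov transform of the vacuum over the coefficient ring `R`. -/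
def IsBogoliubov (v : Fock N R) : Prop := ∃ A : Coeffs N R, v = bogoliubov A

end Exp

/-- `R[Θ, Θ⁻¹][[Q]]`, the formal power series in `Q` whose coefficients are Laurent polynomials in
`Θ`. -/
abbrev Series (R : Type*) [CommRing R] : Type _ := PowerSeries (LaurentPolynomial R)

/-- The inclusion of the constants `R → R[Θ, Θ⁻¹][[Q]]`. -/
def const (R : Type*) [CommRing R] : R →+* Series R :=
  (PowerSeries.C (R := LaurentPolynomial R)).comp LaurentPolynomial.C

/-- Extension of scalars from `R` to `R[Θ, Θ⁻¹][[Q]]`. -/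
def extend (v : Fock N R) : Fock N (Series R) := fun B => const R (v B)

/-- The exponent `ε^{ab}_{ij}`, where `a = 0` and `b = 1`: it is `1` for `(a, b)`, `-1` for `(b, a)`
and `0` for `(a, a)` and `(b, b)`. -/
def thetaExp (i j : Fin 2) : ℤ := ((j : ℕ) : ℤ) - ((i : ℕ) : ℤ)

/-- The gluing vector `P^E_{ab}`, the Bogoliubov transform in `F_a ⊗ F_b` with coefficients
`Q^{m+n+1} Θ^{ε_{ij}} E^{ij}_{mn}`. -/
def gluingVector [Algebra ℚ R] (E : Coeffs 2 R) : Fock 2 (Series R) :=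
  bogoliubov fun i j m n =>
    (PowerSeries.X : Series R) ^ (m + n + 1) *
      PowerSeries.C (LaurentPolynomial.T (R := R) (thetaExp i j)) * const R (E i j m n)

/-- The inner product of `v` and `w` in `F_a ⊗ F_b` is a well-defined formal series: each power of
`Q` occurs in only finitely many terms of `∑_B v_B w_B`. -/
def InnerConverges (v w : Fock 2 (Series R)) : Prop :=
  ∀ d : ℕ, {B : Fin 2 → Maya | PowerSeries.coeff d (v B * w B) ≠ 0}.Finite

/-- The inner product on `F_a ⊗ F_b`, bilinear and with the basis vectors orthonormal, as a formal
series in `Q`. -/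
def inner (v w : Fock 2 (Series R)) : Series R :=
  PowerSeries.mk fun d => ∑ᶠ B : Fin 2 → Maya, PowerSeries.coeff d (v B * w B)

/-- The component in `F_a ⊗ F_b` of `v ∈ F_1 ⊗ ⋯ ⊗ F_M ⊗ F_a ⊗ F_b` along the basis vector `C` of
`F_1 ⊗ ⋯ ⊗ F_M`; the components `a` and `b` of the `M + 2` components are the last two. -/
def slice {M : ℕ} (v : Fock (M + 2) R) (C : Fin M → Maya) : Fock 2 R :=
  fun B => v (Fin.append C B)

variable [Algebra ℚ R] {M : ℕ}

/-- The self-gluing of `v`: the inner product with the gluing vector over `F_a ⊗ F_b`. -/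
def selfGluing (v : Fock (M + 2) R) (E : Coeffs 2 R) : Fock M (Series R) :=
  fun C => inner (slice (extend v) C) (gluingVector E)

/-- The vector `exp (∑_{i,j ∈ {a,b}} ∑_{m,n} A^{ij}_{mn} ψ^i_{m+1/2} ψ^{j*}_{-(n+1/2)}) |0⟩_{ab}`
in `F_a ⊗ F_b`. -/
def closedVector (A : Coeffs (M + 2) R) : Fock 2 R :=
  bogoliubov fun i j => A (Fin.natAdd M i) (Fin.natAdd M j)

/-- The closed part of the self-gluing of `bogoliubov A`. -/
def closedPart (A : Coeffs (M + 2) R) (E : Coeffs 2 R) : Series R :=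
  inner (extend (closedVector A)) (gluingVector E)

/-- The normalized self-gluing of `bogoliubov A`: the self-gluing divided by its closed part. -/
def normalizedSelfGluing (A : Coeffs (M + 2) R) (E : Coeffs 2 R) : Fock M (Series R) :=
  Ring.inverse (closedPart A E) • selfGluing (bogoliubov A) E

end FermionicGluing

end

noncomputable section

namespace FermionicGluing

/-! ### Fermionic configurations, signs and anticommutation relations. -/

section

namespace Maya

/-! Bogoliubov transforms are characterised by a quadratic equation that survives gluing. Relative
to the vacuum, every fermionic operator either creates or annihilates an excitation (a particle or a
hole). Commuting an annihilator through the exponential of a quadratic form in creators gives Wick's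
recursion (`isWick_bogoliubov`), which determines a vector from its vacuum coefficient
(`IsWick.ext`). With antisymmetric coefficients pairing particles with holes, the recursion implies
Hirota's identity, the vanishing of `∑ ψ ⊗ ψ*` on `f ⊗ f` (`IsWick.isBilinear`). Conversely,
Hirota's identity with one argument at a one-excitation configuration is again Wick's recursion. So
a vector with vacuum coefficient 1 that satisfies the identity is a Bogoliubov transform
(`IsBilinear.isBogoliubov`).

The Hirota operator is a sum over components, and its part on the glued components can be moved by
adjunction from `V` to the gluing vector, where it vanishes. Hence the contraction satisfies the
identity on the remaining components (`IsBilinear.contract`). This argument needs finite sums. An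
excitation at distance `l` from the Fermi level forces a factor `Q^(l+1)` in the gluing vector, so
modulo each power of `Q` that vector has finite support. The identity is therefore checked modulo
all powers of `Q`.

The vacuum coefficient of the self-gluing is the closed part, whose constant term in `Q` is 1.
Dividing by it preserves the homogeneous identity and normalises the vacuum coefficient. -/

@[ext] theorem ext {A B : Maya} (h : ∀ k, k ∈ A.1 ↔ k ∈ B.1) : A = B :=
  Subtype.ext (Set.ext h)

@[simp] theorem mem_vacuum {k : ℤ} : k ∈ vacuum.1 ↔ k < 0 := Iff.rfl

@[simp] theorem mem_insert {k r : ℤ} {A : Maya} : k ∈ (A.insert r).1 ↔ k = r ∨ k ∈ A.1 := Iff.rfl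

@[simp] theorem mem_erase {k r : ℤ} {A : Maya} : k ∈ (A.erase r).1 ↔ k ∈ A.1 ∧ k ≠ r := Iff.rfl

theorem above_finite (r : ℤ) (A : Maya) : {k : ℤ | r < k ∧ k ∈ A.1}.Finite := by
  refine (A.2.2.union (Set.finite_Icc r 0)).subset fun k hk => ?_
  rcases le_or_gt 0 k with h | h
  · exact Or.inl ⟨h, hk.2⟩
  · exact Or.inr ⟨hk.1.le, h.le⟩

theorem above_insert {r s : ℤ} {A : Maya} (hs : s ∉ A.1) :
    (A.insert s).above r = A.above r + if r < s then 1 else 0 := by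
  unfold above
  split_ifs with h
  · rw [← Set.ncard_insert_of_notMem (a := s) (fun h' => hs h'.2) (above_finite r A)]
    congr 1
    ext k
    simp only [mem_insert, Set.mem_ofPred_eq, Set.mem_insert_iff]
    grind
  · rw [add_zero]
    congr 1
    ext k
    simp only [mem_insert, Set.mem_ofPred_eq]
    grind

theorem charge_insert {s : ℤ} {A : Maya} (hs : s ∉ A.1) :
    (A.insert s).charge = A.charge + 1 := by
  unfold charge particles holes
  rcases le_or_gt 0 s with h | h
  · have h1 : {k : ℤ | 0 ≤ k ∧ k ∈ (A.insert s).1} = Insert.insert s {k : ℤ | 0 ≤ k ∧ k ∈ A.1} := by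
      ext k; simp only [mem_insert, Set.mem_ofPred_eq, Set.mem_insert_iff]; grind
    have h2 : {k : ℤ | k < 0 ∧ k ∉ (A.insert s).1} = {k : ℤ | k < 0 ∧ k ∉ A.1} := by
      ext k; simp only [mem_insert, Set.mem_ofPred_eq]; grind
    rw [h1, h2, Set.ncard_insert_of_notMem (fun h' => hs h'.2) A.2.2]
    push_cast; ring
  · have h1 : {k : ℤ | 0 ≤ k ∧ k ∈ (A.insert s).1} = {k : ℤ | 0 ≤ k ∧ k ∈ A.1} := by
      ext k; simp only [mem_insert, Set.mem_ofPred_eq]; grind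
    have h2 : {k : ℤ | k < 0 ∧ k ∉ A.1} =
        Insert.insert s {k : ℤ | k < 0 ∧ k ∉ (A.insert s).1} := by
      ext k; simp only [mem_insert, Set.mem_ofPred_eq, Set.mem_insert_iff]; grind
    rw [h1, h2, Set.ncard_insert_of_notMem (fun h' => h'.2 (Or.inl rfl)) (A.insert s).2.1]
    push_cast; ring

theorem charge_vacuum : vacuum.charge = 0 := by
  have h1 : {k : ℤ | 0 ≤ k ∧ k ∈ vacuum.1} = ∅ := by
    ext k; simp only [mem_vacuum, Set.mem_ofPred_eq, Set.mem_empty_iff_false]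
    exact iff_of_false (fun h => absurd h.2 (by have := h.1; omega)) id
  have h2 : {k : ℤ | k < 0 ∧ k ∉ vacuum.1} = ∅ := by
    ext k; simp only [mem_vacuum, Set.mem_ofPred_eq, Set.mem_empty_iff_false]
    exact iff_of_false (fun h => absurd h.2 (by have := h.1; omega)) id
  rw [charge, particles, holes, h1, h2]; simp

open Classical in
/-- The admissible set obtained by changing whether `r` is an element. -/
def toggle (r : ℤ) (A : Maya) : Maya := if r ∈ A.1 then A.erase r else A.insert r

theorem mem_toggle {k r : ℤ} {A : Maya} : k ∈ (A.toggle r).1 ↔ (k ∈ A.1 ↔ k ≠ r) := by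
  unfold toggle
  split_ifs with h
  · simp only [mem_erase]; grind
  · simp only [mem_insert]; grind

theorem insert_erase {r : ℤ} {A : Maya} (h : r ∈ A.1) : (A.erase r).insert r = A := by
  ext k; simp only [mem_insert, mem_erase]; grind

theorem negOnePow_above_toggle (r s : ℤ) (A : Maya) :
    Int.negOnePow ((A.toggle s).above r) =
      (if r < s then -1 else 1) * Int.negOnePow (A.above r) := by
  by_cases h : s ∈ A.1
  · have := above_insert (r := r) (s := s) (A := A.erase s) (by simp)
    rw [insert_erase h] at this
    rw [toggle, if_pos h, this]
    split_ifs <;> simp [Int.negOnePow_succ]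
  · rw [toggle, if_neg h, above_insert h]
    split_ifs <;> simp [Int.negOnePow_succ]

theorem negOnePow_charge_toggle (s : ℤ) (A : Maya) :
    Int.negOnePow (A.toggle s).charge = - Int.negOnePow A.charge := by
  by_cases h : s ∈ A.1
  · have := charge_insert (s := s) (A := A.erase s) (by simp)
    rw [insert_erase h] at this
    rw [toggle, if_pos h, this]
    simp [Int.negOnePow_succ]
  · rw [toggle, if_neg h, charge_insert h]
    simp [Int.negOnePow_succ]

end Maya

variable {N : ℕ} {R : Type*} [CommRing R]

/-- The index of a fermion: its component and its half-integer. -/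
abbrev Idx (N : ℕ) : Type := Fin N × ℤ

/-- The half-integer of `x` belongs to the component of `x` in `B`. -/
def Occ (x : Idx N) (B : Fin N → Maya) : Prop := x.2 ∈ (B x.1).1

/-- Change the occupation of `x`. -/
def toggle (x : Idx N) (B : Fin N → Maya) : Fin N → Maya :=
  Function.update B x.1 ((B x.1).toggle x.2)

theorem conf_ext {B C : Fin N → Maya} (h : ∀ x, Occ x B ↔ Occ x C) : B = C :=
  funext fun i => Maya.ext fun k => h (i, k)

theorem occ_toggle {x y : Idx N} {B : Fin N → Maya} :
    Occ x (toggle y B) ↔ (Occ x B ↔ x ≠ y) := by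
  obtain ⟨i, r⟩ := x
  obtain ⟨j, s⟩ := y
  unfold Occ toggle
  by_cases h : i = j
  · subst h
    simp [Maya.mem_toggle]
  · simp [h]

@[simp] theorem toggle_toggle (x : Idx N) (B : Fin N → Maya) : toggle x (toggle x B) = B :=
  conf_ext fun y => by simp only [occ_toggle]; tauto

theorem toggle_comm (x y : Idx N) (B : Fin N → Maya) :
    toggle x (toggle y B) = toggle y (toggle x B) :=
  conf_ext fun z => by simp only [occ_toggle]; tauto

/-- The excited indices of a configuration are those of its particles and of its holes. -/
def Excited (x : Idx N) (B : Fin N → Maya) : Prop := 0 ≤ x.2 ↔ Occ x B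

theorem excited_toggle {x y : Idx N} {B : Fin N → Maya} :
    Excited x (toggle y B) ↔ (Excited x B ↔ x ≠ y) := by
  simp only [Excited, occ_toggle]; tauto

theorem excited_finite (B : Fin N → Maya) : {x | Excited x B}.Finite := by
  have h : ∀ i, {k : ℤ | Excited (i, k) B}.Finite := fun i =>
    ((B i).2.1.union (B i).2.2).subset fun k hk => by
      simp only [Excited, Occ, Set.mem_ofPred_eq] at hk
      rcases le_or_gt 0 k with h | h
      · exact Or.inr ⟨h, hk.1 h⟩
      · exact Or.inl ⟨h, fun h' => absurd (hk.2 h') (not_le.2 h)⟩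
  refine (Set.finite_iUnion fun i => (h i).image (Prod.mk i)).subset fun x hx => ?_
  exact Set.mem_iUnion.2 ⟨x.1, x.2, hx, rfl⟩

/-- The finite set of excited indices of a configuration. -/
def excitations (B : Fin N → Maya) : Finset (Idx N) := (excited_finite B).toFinset

@[simp] theorem mem_excitations {x : Idx N} {B : Fin N → Maya} :
    x ∈ excitations B ↔ Excited x B := by simp [excitations]

/-- The excitations record the difference from the vacuum. Finiteness of a set of configurations,
and recognition of the vacuum, thus reduce to finite sets of indices. -/
theorem excitations_injective : Function.Injective (excitations (N := N)) := fun B C h =>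
  conf_ext fun x => by
    have := Finset.ext_iff.1 h x
    simp only [mem_excitations, Excited] at this
    tauto

/-- The configuration of the vacuum. -/
def vacConf (N : ℕ) : Fin N → Maya := fun _ => Maya.vacuum

theorem not_excited_vacConf (x : Idx N) : ¬ Excited x (vacConf N) := by
  simp only [Excited, Occ, vacConf, Maya.mem_vacuum]
  intro h
  rcases lt_or_ge x.2 0 with h' | h'
  · exact absurd (h.2 h') (not_le.2 h')
  · exact absurd (h.1 h') (not_lt.2 h')

theorem eq_vacConf {B : Fin N → Maya} (h : ∀ x, ¬ Excited x B) : B = vacConf N :=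
  excitations_injective (Finset.ext fun x => by simp [h, not_excited_vacConf])

theorem vac_apply_vacConf : vac N R (vacConf N) = 1 := by
  classical
  simp only [vac]
  exact Pi.single_eq_same (M := fun _ => R) _ _

theorem vac_apply_of_ne {B : Fin N → Maya} (h : B ≠ vacConf N) : vac N R B = 0 := by
  classical
  simp only [vac]
  exact Pi.single_eq_of_ne (M := fun _ => R) h _

/-- The order of the fermions in the wedge product. -/
def Before (y x : Idx N) : Prop := y.1 < x.1 ∨ y.1 = x.1 ∧ x.2 < y.2

theorem before_iff_not {x y : Idx N} (h : x ≠ y) : Before x y ↔ ¬ Before y x := by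
  obtain ⟨i, r⟩ := x
  obtain ⟨j, s⟩ := y
  simp only [Before, ne_eq, Prod.mk.injEq] at *
  grind

theorem not_before_self (x : Idx N) : ¬ Before x x := by
  simp [Before]

open Classical in
theorem sign_toggle (x y : Idx N) (B : Fin N → Maya) :
    sign x.1 x.2 (toggle y B) = (if Before y x then -1 else 1) * sign x.1 x.2 B := by
  obtain ⟨i, r⟩ := x
  obtain ⟨j, s⟩ := y
  have hb : Before (j, s) (i, r) ↔ j < i ∨ j = i ∧ r < s := Iff.rfl
  simp only [sign, Int.negOnePow_add, toggle, hb]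
  have hsum : ∀ f : Fin N → ℤ, Int.negOnePow (∑ l ∈ Finset.univ.filter (· < i), f l)
      = ∏ l ∈ Finset.univ.filter (· < i), Int.negOnePow (f l) := fun f => by
    induction (Finset.univ.filter (· < i)) using Finset.induction_on with
    | empty => simp
    | insert a t ha ih => rw [Finset.sum_insert ha, Finset.prod_insert ha, Int.negOnePow_add, ih]
  rw [hsum, hsum]
  -- Changing an earlier component flips its charge parity, changing the same component affects the
  -- count of larger elements, and a later component is invisible.
  rcases lt_trichotomy j i with h | rfl | h
  · rw [Function.update_of_ne h.ne', if_pos (Or.inl h)]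
    have hj : j ∈ Finset.univ.filter (· < i) := by simp [h]
    rw [← Finset.mul_prod_erase _ _ hj, ← Finset.mul_prod_erase _ _ hj, Function.update_self,
      Maya.negOnePow_charge_toggle]
    rw [Finset.prod_congr rfl fun l hl => by rw [Function.update_of_ne (Finset.ne_of_mem_erase hl)]]
    simp
  · rw [Function.update_self, Maya.negOnePow_above_toggle]
    rw [Finset.prod_congr rfl fun l hl => by
      rw [Function.update_of_ne (Finset.mem_filter.1 hl).2.ne]]
    by_cases h : r < s
    · simp [h]
    · simp [h]
  · rw [Function.update_of_ne h.ne, if_neg (by rintro (h' | h') <;> omega)]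
    rw [Finset.prod_congr rfl fun l hl => by
      rw [Function.update_of_ne ((Finset.mem_filter.1 hl).2.trans h).ne]]
    simp

/-- The sign of the fermionic operators of index `x` at `B`, as a scalar. -/
def sgn (R : Type*) [CommRing R] (x : Idx N) (B : Fin N → Maya) : R :=
  ((sign x.1 x.2 B : ℤˣ) : ℤ)

@[simp] theorem sgn_mul_self (x : Idx N) (B : Fin N → Maya) : sgn R x B * sgn R x B = 1 := by
  rw [sgn, ← Int.cast_mul, ← Units.val_mul, Int.units_mul_self]; simp

open Classical in
theorem sgn_toggle (x y : Idx N) (B : Fin N → Maya) :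
    sgn R x (toggle y B) = if Before y x then -sgn R x B else sgn R x B := by
  rw [sgn, sign_toggle]
  split_ifs <;> simp [sgn]

@[simp] theorem sgn_toggle_self (x : Idx N) (B : Fin N → Maya) :
    sgn R x (toggle x B) = sgn R x B := by
  rw [sgn_toggle, if_neg (not_before_self x)]

theorem map_sgn {S : Type*} [CommRing S] (φ : R →+* S) (x : Idx N) (B : Fin N → Maya) :
    φ (sgn R x B) = sgn S x B := by
  simp [sgn]

/-- Exchanging two different indices in a product of signs changes the sign. -/
theorem sgn_mul_sgn_toggle {x y : Idx N} (h : x ≠ y) (B : Fin N → Maya) :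
    sgn R x B * sgn R y (toggle x B) = - (sgn R y B * sgn R x (toggle y B)) := by
  rw [sgn_toggle, sgn_toggle]
  have := before_iff_not h
  by_cases h' : Before x y
  · rw [if_pos h', if_neg (this.1 h')]; ring
  · rw [if_neg h', if_pos (not_not.1 fun h'' => h' (this.2 h''))]; ring

/-- The operator that adds an excitation of index `x`. -/
def creator (x : Idx N) : Fock N R →ₗ[R] Fock N R :=
  if 0 ≤ x.2 then psi x.1 x.2 else psiStar x.1 x.2

/-- The operator that removes an excitation of index `x`. -/
def annihilator (x : Idx N) : Fock N R →ₗ[R] Fock N R :=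
  if 0 ≤ x.2 then psiStar x.1 x.2 else psi x.1 x.2

open Classical in
theorem psi_apply (x : Idx N) (f : Fock N R) (B : Fin N → Maya) :
    psi x.1 x.2 f B = if Occ x B then sgn R x B * f (toggle x B) else 0 := by
  simp only [psi, LinearMap.coe_mk, AddHom.coe_mk, Occ, toggle, Maya.toggle, sgn]
  split_ifs with h <;> simp [Units.smul_def]

open Classical in
theorem psiStar_apply (x : Idx N) (f : Fock N R) (B : Fin N → Maya) :
    psiStar x.1 x.2 f B = if Occ x B then 0 else sgn R x B * f (toggle x B) := by
  simp only [psiStar, LinearMap.coe_mk, AddHom.coe_mk, Occ, toggle, Maya.toggle, sgn]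
  split_ifs with h <;> simp [Units.smul_def]

open Classical in
theorem creator_apply (x : Idx N) (f : Fock N R) (B : Fin N → Maya) :
    creator x f B = if Excited x B then sgn R x B * f (toggle x B) else 0 := by
  unfold creator Excited
  split_ifs with h1 h2 h2
  · rw [psi_apply, if_pos (h2.1 h1)]
  · rw [psi_apply, if_neg (by tauto)]
  · rw [psiStar_apply, if_neg (by tauto)]
  · rw [psiStar_apply, if_pos (by tauto)]

open Classical in
theorem annihilator_apply (x : Idx N) (f : Fock N R) (B : Fin N → Maya) :
    annihilator x f B = if Excited x B then 0 else sgn R x B * f (toggle x B) := by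
  unfold annihilator Excited
  split_ifs with h1 h2 h2
  · rw [psiStar_apply, if_pos (h2.1 h1)]
  · rw [psiStar_apply, if_neg (by tauto)]
  · rw [psi_apply, if_neg (by tauto)]
  · rw [psi_apply, if_pos (by tauto)]

theorem creator_apply_of_not {x : Idx N} {B : Fin N → Maya} (h : ¬ Excited x B) (f : Fock N R) :
    creator x f B = 0 := by
  rw [creator_apply, if_neg h]

/-- For distinct indices this is the antisymmetry of the signs. For equal indices both sides vanish,
because toggling an excited index makes it unexcited. -/
theorem creator_creator (x y : Idx N) (f : Fock N R) :
    creator x (creator y f) = - creator y (creator x f) := by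
  funext B
  simp only [Pi.neg_apply, creator_apply]
  by_cases h : x = y
  · subst h
    have h1 : Excited x (toggle x B) ↔ ¬ Excited x B := by simp [excited_toggle]
    by_cases hx : Excited x B <;> simp [hx, h1]
  · have h1 : Excited x (toggle y B) ↔ Excited x B := by simp [excited_toggle, h]
    have h2 : Excited y (toggle x B) ↔ Excited y B := by simp [excited_toggle, Ne.symm h]
    by_cases hx : Excited x B <;> by_cases hy : Excited y B <;> simp [hx, hy, h1, h2]
    rw [← mul_assoc, ← mul_assoc, sgn_mul_sgn_toggle h, toggle_comm x y]; ring

theorem annihilator_creator_of_ne {x y : Idx N} (h : x ≠ y) (f : Fock N R) :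
    annihilator x (creator y f) = - creator y (annihilator x f) := by
  funext B
  have h1 : Excited x (toggle y B) ↔ Excited x B := by simp [excited_toggle, h]
  have h2 : Excited y (toggle x B) ↔ Excited y B := by simp [excited_toggle, Ne.symm h]
  simp only [Pi.neg_apply, creator_apply, annihilator_apply]
  by_cases hx : Excited x B <;> by_cases hy : Excited y B <;> simp [hx, hy, h1, h2]
  rw [← mul_assoc, ← mul_assoc, sgn_mul_sgn_toggle h, toggle_comm x y]; ring

theorem annihilator_creator_self (x : Idx N) (f : Fock N R) :
    annihilator x (creator x f) = f - creator x (annihilator x f) := by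
  funext B
  have h1 : Excited x (toggle x B) ↔ ¬ Excited x B := by simp [excited_toggle]
  simp only [Pi.sub_apply, creator_apply, annihilator_apply]
  by_cases hx : Excited x B <;> simp [hx, h1, ← mul_assoc]

theorem annihilator_vac (x : Idx N) : annihilator x (vac N R) = 0 := by
  classical
  funext B
  rw [annihilator_apply]
  split_ifs with h
  · rfl
  · rw [vac_apply_of_ne, mul_zero]; · rfl
    intro h'
    have : Excited x (toggle x B) := by rw [excited_toggle]; simp [h]
    exact not_excited_vacConf x (h' ▸ this)

end

/-! ### Wick's recursion for Bogoliubov transforms. -/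

section

variable {N : ℕ} {R : Type*} [CommRing R]

/-- The coefficient of `creator x ∘ creator y` in `quad A`. -/
def coupling (A : Coeffs N R) (x y : Idx N) : R :=
  if 0 ≤ x.2 ∧ y.2 < 0 then A x.1 y.1 x.2.toNat (-y.2 - 1).toNat else 0

/-- The antisymmetrized coefficients of `quad A`. -/
def pairing (A : Coeffs N R) (x y : Idx N) : R := coupling A x y - coupling A y x

/-- The part of `quad A` that creates excitations in `S`. -/
def quadOn (A : Coeffs N R) (S : Finset (Idx N)) : Fock N R →ₗ[R] Fock N R :=
  ∑ x ∈ S, ∑ y ∈ S, coupling A x y • (creator x ∘ₗ creator y)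

theorem quadOn_apply (A : Coeffs N R) (S : Finset (Idx N)) (f : Fock N R) :
    quadOn A S f = ∑ x ∈ S, ∑ y ∈ S, coupling A x y • creator x (creator y f) := by
  simp [quadOn, LinearMap.sum_apply]

theorem creator_creator_apply_of_not {x y : Idx N} {B : Fin N → Maya} (f : Fock N R)
    (h : ¬ (Excited x B ∧ Excited y B)) : creator x (creator y f) B = 0 := by
  by_cases hx : Excited x B
  · rw [creator_creator, Pi.neg_apply, creator_apply_of_not (fun hy => h ⟨hx, hy⟩), neg_zero]
  · exact creator_apply_of_not hx _

/-- A product of two creators has zero coefficient at `B` unless both indices are excited there. The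
infinite quadratic form therefore acts at `B` as a finite one, and commutators can be computed with
finite sums. -/
theorem quad_apply_of_subset (A : Coeffs N R) (f : Fock N R) {B : Fin N → Maya}
    {S : Finset (Idx N)} (hS : excitations B ⊆ S) : quad A f B = quadOn A S f B := by
  set F : Idx N × Idx N → R := fun q => coupling A q.1 q.2 * creator q.1 (creator q.2 f) B
    with hF
  have hsupp : Function.support F ⊆ ↑(S ×ˢ S) := fun q hq => by
    by_contra hne
    refine hq ?_
    simp only [hF]
    rw [creator_creator_apply_of_not, mul_zero]
    rintro ⟨h1, h2⟩
    exact hne (by simpa using ⟨hS (mem_excitations.2 h1), hS (mem_excitations.2 h2)⟩)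
  have hR : quadOn A S f B = ∑ᶠ q, F q := by
    rw [finsum_eq_sum_of_support_subset _ hsupp, Finset.sum_product, quadOn_apply]
    simp [Finset.sum_apply, hF]
  set e : (Fin N × Fin N) × (ℕ × ℕ) → Idx N × Idx N :=
    fun q => ((q.1.1, (q.2.1 : ℤ)), (q.1.2, -(q.2.2 : ℤ) - 1)) with he
  have hinj : Function.Injective e := by
    rintro ⟨⟨i, j⟩, m, n⟩ ⟨⟨i', j'⟩, m', n'⟩ h
    simp only [he, Prod.mk.injEq] at h ⊢
    omega
  have hFe : ∀ q : (Fin N × Fin N) × (ℕ × ℕ),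
      A q.1.1 q.1.2 q.2.1 q.2.2 * pair q.1.1 q.1.2 q.2.1 q.2.2 f B = F (e q) := by
    intro q
    have h1 : ¬ (0 ≤ -(q.2.2 : ℤ) - 1) := by omega
    have h2 : -(q.2.2 : ℤ) - 1 < 0 := by omega
    simp only [hF, he, coupling, creator, pair, LinearMap.comp_apply, Int.natCast_nonneg, if_true,
      if_neg h1, h2, and_self, Int.toNat_natCast]
    congr 2
    simp
  have hfin : (Function.support (F ∘ e)).Finite :=
    ((S ×ˢ S).finite_toSet.subset hsupp).preimage hinj.injOn
  have hL : quad A f B = ∑ᶠ q, F (e q) := by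
    rw [finsum_curry (fun q => F (e q)) hfin, finsum_eq_sum_of_fintype, Fintype.sum_prod_type]
    change ∑ i, ∑ j, ∑ᶠ p : ℕ × ℕ, A i j p.1 p.2 * pair i j p.1 p.2 f B = _
    refine Finset.sum_congr rfl fun i _ => Finset.sum_congr rfl fun j _ => ?_
    exact finsum_congr fun p => hFe ((i, j), p)
  -- The map `e` reaches exactly the pairs of a nonnegative and a negative half-integer. Outside
  -- this range `coupling` vanishes, so nothing is lost.
  rw [hL, hR, ← finsum_mem_range hinj, ← finsum_mem_univ F]
  refine finsum_mem_inter_support_eq _ _ _ ?_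
  rw [Set.univ_inter]
  refine Set.inter_eq_right.2 fun q hq => ?_
  have h3 : 0 ≤ q.1.2 ∧ q.2.2 < 0 := by
    by_contra h
    exact hq (by simp only [hF, coupling, if_neg h, zero_mul])
  refine ⟨((q.1.1, q.2.1), (q.1.2.toNat, (-q.2.2 - 1).toNat)), ?_⟩
  obtain ⟨⟨i, r⟩, j, s⟩ := q
  simp only [he, Prod.mk.injEq, true_and]
  simp only at h3
  omega

theorem excitations_toggle_subset {x : Idx N} {B : Fin N → Maya} {S : Finset (Idx N)}
    (hx : x ∈ S) (hS : excitations B ⊆ S) : excitations (toggle x B) ⊆ S := fun y hy => by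
  rw [mem_excitations, excited_toggle] at hy
  by_cases h : y = x
  · exact h ▸ hx
  · exact hS (mem_excitations.2 (hy.2 h))

/-- Creators only see coefficients at configurations with fewer excitations. -/
theorem creator_congr {f g : Fock N R} {S : Finset (Idx N)} (x : Idx N)
    (h : ∀ B, excitations B ⊆ S → f B = g B) (B : Fin N → Maya) (hB : excitations B ⊆ S) :
    creator x f B = creator x g B := by
  classical
  rw [creator_apply, creator_apply]
  split_ifs with hx
  · rw [h _ (excitations_toggle_subset (hB (mem_excitations.2 hx)) hB)]
  · rfl

theorem annihilator_congr {f g : Fock N R} {S : Finset (Idx N)} {x : Idx N} (hxS : x ∈ S)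
    (h : ∀ B, excitations B ⊆ S → f B = g B) (B : Fin N → Maya) (hB : excitations B ⊆ S) :
    annihilator x f B = annihilator x g B := by
  classical
  rw [annihilator_apply, annihilator_apply, h _ (excitations_toggle_subset hxS hB)]

/-- The commutator of `annihilator z` with the part of `quad A` that creates excitations
in `S`. -/
def contractionOn (A : Coeffs N R) (z : Idx N) (S : Finset (Idx N)) : Fock N R →ₗ[R] Fock N R :=
  ∑ y ∈ S, pairing A z y • creator y

theorem contractionOn_apply (A : Coeffs N R) (z : Idx N) (S : Finset (Idx N)) (f : Fock N R) :
    contractionOn A z S f = ∑ y ∈ S, pairing A z y • creator y f := by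
  simp [contractionOn, LinearMap.sum_apply]

theorem contractionOn_apply_of_subset (A : Coeffs N R) (z : Idx N) {S : Finset (Idx N)}
    (f : Fock N R) {B : Fin N → Maya} (hS : excitations B ⊆ S) :
    contractionOn A z (excitations B) f B = contractionOn A z S f B := by
  simp only [contractionOn_apply, Finset.sum_apply, Pi.smul_apply, smul_eq_mul]
  refine Finset.sum_subset hS fun y _ hy => ?_
  rw [creator_apply_of_not (by simpa using hy), mul_zero]

/-- The commutator of `annihilator z` with `quad A`. -/
def contraction (A : Coeffs N R) (z : Idx N) : Fock N R →ₗ[R] Fock N R where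
  toFun f B := contractionOn A z (excitations B) f B
  map_add' f g := by funext B; simp
  map_smul' r f := by funext B; simp

theorem contraction_apply_of_subset (A : Coeffs N R) (z : Idx N) {S : Finset (Idx N)}
    (f : Fock N R) {B : Fin N → Maya} (hS : excitations B ⊆ S) :
    contraction A z f B = contractionOn A z S f B :=
  contractionOn_apply_of_subset A z f hS

/-- Contracting `z` with the first or with the second creator produces opposite signs. This is why
the antisymmetrised coefficients appear. -/
theorem annihilator_quadOn (A : Coeffs N R) {z : Idx N} {S : Finset (Idx N)} (hz : z ∈ S)
    (f : Fock N R) :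
    annihilator z (quadOn A S f) = quadOn A S (annihilator z f) + contractionOn A z S f := by
  classical
  have key : ∀ x y : Idx N, annihilator z (creator x (creator y f)) =
      creator x (creator y (annihilator z f)) + (if z = x then creator y f else 0)
        - (if z = y then creator x f else 0) := by
    intro x y
    by_cases hx : z = x
    · subst hx
      rw [annihilator_creator_self]
      by_cases hy : z = y
      · subst hy
        rw [annihilator_creator_self]
        simp only [if_true, map_sub]
        abel
      · rw [annihilator_creator_of_ne hy, if_pos rfl, if_neg hy, map_neg]
        abel
    · rw [annihilator_creator_of_ne hx]
      by_cases hy : z = y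
      · subst hy
        rw [annihilator_creator_self, if_neg hx, if_pos rfl, map_sub]
        abel
      · rw [annihilator_creator_of_ne hy, if_neg hx, if_neg hy, map_neg]
        abel
  simp only [quadOn_apply, contractionOn_apply, map_sum, map_smul, key, smul_add, smul_sub,
    Finset.sum_add_distrib, Finset.sum_sub_distrib, pairing, sub_smul, smul_ite, smul_zero,
    Finset.sum_ite_eq, hz, if_true]
  rw [Finset.sum_comm (f := fun x y => if z = x then coupling A x y • creator y f else 0)]
  simp only [Finset.sum_ite_eq, hz, if_true]
  abel

/-- A creator anticommutes with both factors of a pair, so the two signs cancel. -/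
theorem contractionOn_quadOn (A : Coeffs N R) (z : Idx N) (S : Finset (Idx N)) (f : Fock N R) :
    contractionOn A z S (quadOn A S f) = quadOn A S (contractionOn A z S f) := by
  have key : ∀ w x y : Idx N, creator w (creator x (creator y f)) =
      creator x (creator y (creator w f)) := fun w x y => by
    rw [creator_creator w x, creator_creator w y, map_neg, neg_neg]
  simp only [quadOn_apply, contractionOn_apply, map_sum, map_smul, key, Finset.smul_sum]
  symm
  rw [Finset.sum_comm]
  refine Finset.sum_congr rfl fun x _ => ?_
  rw [Finset.sum_comm]
  exact Finset.sum_congr rfl fun y _ => Finset.sum_congr rfl fun w _ => smul_comm _ _ _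

theorem quadOn_congr {A : Coeffs N R} {f g : Fock N R} {S : Finset (Idx N)}
    (h : ∀ B, excitations B ⊆ S → f B = g B) (B : Fin N → Maya) (hB : excitations B ⊆ S) :
    quadOn A S f B = quadOn A S g B := by
  simp only [quadOn_apply, Finset.sum_apply, Pi.smul_apply]
  refine Finset.sum_congr rfl fun x _ => Finset.sum_congr rfl fun y _ => ?_
  rw [creator_congr x (creator_congr y h) B hB]

theorem annihilator_quad (A : Coeffs N R) (z : Idx N) (f : Fock N R) :
    annihilator z (quad A f) = quad A (annihilator z f) + contraction A z f := by
  classical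
  funext B
  -- The annihilator looks at `toggle z B`, so the finite set has to contain `z` as well.
  have hS : excitations B ⊆ insert z (excitations B) := Finset.subset_insert _ _
  have hz := Finset.mem_insert_self z (excitations B)
  rw [annihilator_congr hz (fun B' hB' => quad_apply_of_subset A f hB') B hS,
    annihilator_quadOn A hz, Pi.add_apply, Pi.add_apply, quad_apply_of_subset A _ hS,
    contraction_apply_of_subset A z f hS]

theorem contraction_quad (A : Coeffs N R) (z : Idx N) (f : Fock N R) :
    contraction A z (quad A f) = quad A (contraction A z f) := by
  funext B
  have hS := Finset.Subset.refl (excitations B)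
  rw [contraction_apply_of_subset A z _ hS, quad_apply_of_subset A _ hS,
    quadOn_congr (fun B' hB' => contraction_apply_of_subset A z f hB') B hS,
    ← contractionOn_quadOn]
  simp only [contractionOn_apply, Finset.sum_apply, Pi.smul_apply]
  refine Finset.sum_congr rfl fun y _ => ?_
  rw [creator_congr y (fun B' hB' => quad_apply_of_subset A f hB') B hS]

/-- Moving the annihilator through the `k + 1` factors leaves one contraction for each. All of these
agree because the contraction commutes with `quad A`, and the remaining term dies on the vacuum. -/
theorem annihilator_quad_pow_vac (A : Coeffs N R) (z : Idx N) (k : ℕ) :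
    annihilator z ((quad A ^ (k + 1)) (vac N R)) =
      (k + 1 : R) • contraction A z ((quad A ^ k) (vac N R)) := by
  induction k with
  | zero => simp [annihilator_quad, annihilator_vac]
  | succ k ih =>
    have h : quad A ((quad A ^ k) (vac N R)) = (quad A ^ (k + 1)) (vac N R) := by
      rw [pow_succ', Module.End.mul_apply]
    rw [pow_succ', Module.End.mul_apply, annihilator_quad, ih, map_smul, ← contraction_quad, h]
    push_cast
    module

/-- Wick's theorem in recursive form: removing an excitation amounts to the sum over all ways to
contract it with another one. -/
def IsWick (a : Idx N → Idx N → R) (f : Fock N R) : Prop :=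
  ∀ z B, annihilator z f B = ∑ y ∈ excitations B, a z y * creator y f B

section Exp

variable [Algebra ℚ R]

theorem expQuad_apply (A : Coeffs N R) (f : Fock N R) {B : Fin N → Maya} {K : ℕ}
    (hK : ∑ i, (B i).particles < K) : expQuad A f B =
      ∑ k ∈ Finset.range K, ((k.factorial : ℚ)⁻¹) • ((quad A) ^ k) f B := by
  refine finsum_eq_sum_of_support_subset _ fun k hk => ?_
  by_contra hlt
  refine hk ?_
  simp only [Finset.coe_range, Set.mem_Iio] at hlt
  simp only [quad_pow_eq_zero A f k B (by omega), smul_zero]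

theorem bogoliubov_vacConf (A : Coeffs N R) : bogoliubov A (vacConf N) = 1 := by
  have h : ∑ i, (vacConf N i).particles < 1 := by
    have h1 : {k : ℤ | 0 ≤ k ∧ k ∈ Maya.vacuum.1} = ∅ := by
      ext k
      simp only [Maya.mem_vacuum, Set.mem_ofPred_eq, Set.mem_empty_iff_false]
      exact iff_of_false (fun h => absurd h.2 (by have := h.1; omega)) id
    simp only [vacConf, Maya.particles, h1, Set.ncard_empty, Finset.sum_const_zero, zero_lt_one]
  rw [bogoliubov, expQuad_apply A _ h]
  simp [vac_apply_vacConf]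

theorem isWick_bogoliubov (A : Coeffs N R) : IsWick (pairing A) (bogoliubov A) := by
  classical
  intro z B
  -- One cutoff bounds the particle number of every configuration in the recursion, so all
  -- exponential series truncate together. The annihilator side keeps one more term, since
  -- contraction lowers the power by one.
  obtain ⟨K, hK⟩ : ∃ K, ∀ y ∈ insert z (excitations B),
      ∑ i, (toggle y B i).particles < K := by
    refine ⟨(insert z (excitations B)).sup (fun y => ∑ i, (toggle y B i).particles) + 1,
      fun y hy => Nat.lt_succ_of_le ?_⟩
    exact Finset.le_sup (f := fun y => ∑ i, (toggle y B i).particles) hy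
  have h1 : annihilator z (bogoliubov A) B = ∑ k ∈ Finset.range (K + 1),
      ((k.factorial : ℚ)⁻¹) • annihilator z ((quad A ^ k) (vac N R)) B := by
    simp only [annihilator_apply]
    split_ifs
    · simp
    · rw [bogoliubov, expQuad_apply A _ ((hK z (Finset.mem_insert_self _ _)).trans K.lt_succ_self),
        Finset.mul_sum]
      simp only [mul_smul_comm]
  have h2 : ∀ y ∈ excitations B, creator y (bogoliubov A) B = ∑ k ∈ Finset.range K,
      ((k.factorial : ℚ)⁻¹) • creator y ((quad A ^ k) (vac N R)) B := by
    intro y hy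
    simp only [creator_apply, if_pos (mem_excitations.1 hy)]
    rw [bogoliubov, expQuad_apply A _ (hK y (Finset.mem_insert_of_mem hy)), Finset.mul_sum]
    simp only [mul_smul_comm]
  -- The zeroth term vanishes because annihilators kill the vacuum. The shifted terms match through
  -- `(k + 1) / (k + 1)! = 1 / k!`.
  rw [h1, Finset.sum_range_succ']
  simp only [pow_zero, Module.End.one_apply, annihilator_vac, Pi.zero_apply, smul_zero, add_zero,
    annihilator_quad_pow_vac, Pi.smul_apply, smul_eq_mul]
  have h5 : ∑ y ∈ excitations B, pairing A z y * creator y (bogoliubov A) B =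
      ∑ y ∈ excitations B, ∑ k ∈ Finset.range K,
        pairing A z y * ((k.factorial : ℚ)⁻¹ • creator y ((quad A ^ k) (vac N R)) B) :=
    Finset.sum_congr rfl fun y hy => by rw [h2 y hy, Finset.mul_sum]
  rw [h5, Finset.sum_comm]
  refine Finset.sum_congr rfl fun k _ => ?_
  rw [contraction_apply_of_subset A z _ (Finset.Subset.refl _), contractionOn_apply,
    Finset.sum_apply, Finset.mul_sum, Finset.smul_sum]
  refine Finset.sum_congr rfl fun y _ => ?_
  have h3 : (k + 1 : R) = algebraMap ℚ R (k + 1) := by simp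
  have h4 : ((k + 1).factorial : ℚ)⁻¹ * (k + 1) = (k.factorial : ℚ)⁻¹ := by
    rw [Nat.factorial_succ]
    have := k.factorial_ne_zero
    push_cast
    field_simp
  rw [h3, ← Algebra.smul_def, smul_smul, h4, Pi.smul_apply, smul_eq_mul, mul_smul_comm]

end Exp

/-- The recursion determines a vector up to its vacuum coefficient. -/
theorem IsWick.ext {a : Idx N → Idx N → R} {f g : Fock N R} (hf : IsWick a f) (hg : IsWick a g)
    (h : f (vacConf N) = g (vacConf N)) : f = g := by
  classical
  suffices H : ∀ n, ∀ B : Fin N → Maya, (excitations B).card = n → f B = g B from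
    funext fun B => H _ B rfl
  intro n
  induction n using Nat.strong_induction_on with
  | _ n ih =>
    intro B hB
    -- At `toggle z B` the annihilator returns the coefficient at `B` up to sign, while the right
    -- side of the recursion only involves configurations with fewer excitations.
    by_cases hv : ∃ z, Excited z B
    · obtain ⟨z, hz⟩ := hv
      have hz' : ¬ Excited z (toggle z B) := by simp [excited_toggle, hz]
      have hex : excitations (toggle z B) = (excitations B).erase z := by
        ext y
        simp only [mem_excitations, excited_toggle, Finset.mem_erase]
        by_cases hy : y = z
        · subst hy; simp [hz]
        · simp [hy]
      have hlt : (excitations (toggle z B)).card < n := by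
        rw [hex, ← hB]
        exact Finset.card_erase_lt_of_mem (mem_excitations.2 hz)
      have h1 : annihilator z f (toggle z B) = annihilator z g (toggle z B) := by
        rw [hf, hg]
        refine Finset.sum_congr rfl fun y hy => ?_
        have hy' := mem_excitations.1 hy
        rw [creator_apply, creator_apply, if_pos hy', if_pos hy']
        rw [ih _ ?_ (toggle y (toggle z B)) rfl]
        refine lt_of_le_of_lt (Finset.card_le_card ?_) hlt
        exact excitations_toggle_subset hy (Finset.Subset.refl _)
      rw [annihilator_apply, annihilator_apply, if_neg hz', if_neg hz', toggle_toggle] at h1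
      have h2 := congrArg (sgn R z (toggle z B) * ·) h1
      simpa [← mul_assoc] using h2
    · rw [eq_vacConf (not_exists.1 hv), h]

/-! ### Equivalence of Wick's recursion and Hirota's bilinear identity. -/

open Classical in
/-- The terms of Hirota's bilinear form `∑ ψ ⊗ ψ*` at `f ⊗ g`. -/
def bilinTerm (f g : Fock N R) (B₁ B₂ : Fin N → Maya) (x : Idx N) : R :=
  if Occ x B₁ ∧ ¬ Occ x B₂ then
    sgn R x B₁ * sgn R x B₂ * (f (toggle x B₁) * g (toggle x B₂)) else 0

/-- Hirota's bilinear identity. -/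
def IsBilinear (f : Fock N R) : Prop := ∀ B₁ B₂, ∑ᶠ x, bilinTerm f f B₁ B₂ x = 0

theorem finite_occ_diff (B₁ B₂ : Fin N → Maya) : {x | Occ x B₁ ∧ ¬ Occ x B₂}.Finite := by
  refine ((excited_finite B₁).union (excited_finite B₂)).subset fun x hx => ?_
  simp only [Set.mem_union, Set.mem_ofPred_eq, Excited] at hx ⊢
  tauto

theorem support_bilinTerm_subset (f g : Fock N R) (B₁ B₂ : Fin N → Maya) :
    Function.support (bilinTerm f g B₁ B₂) ⊆ {x | Occ x B₁ ∧ ¬ Occ x B₂} := fun x hx => by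
  by_contra h
  exact hx (if_neg h)

/-- In terms of excitations, each summand pairs one creator with one annihilator, with their roles
exchanged on the hole side. This form admits substitution of Wick's recursion. -/
theorem bilinTerm_eq (f : Fock N R) (B₁ B₂ : Fin N → Maya) (x : Idx N) :
    bilinTerm f f B₁ B₂ x = if 0 ≤ x.2 then creator x f B₁ * annihilator x f B₂
      else annihilator x f B₁ * creator x f B₂ := by
  classical
  have h : bilinTerm f f B₁ B₂ x = psi x.1 x.2 f B₁ * psiStar x.1 x.2 f B₂ := by
    rw [psi_apply, psiStar_apply, bilinTerm]
    by_cases h1 : Occ x B₁ <;> by_cases h2 : Occ x B₂ <;> simp [h1, h2]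
    ring
  rw [h, creator, annihilator]
  split_ifs <;> rfl

theorem finsum_bilinTerm (f : Fock N R) {B₁ B₂ : Fin N → Maya} {S : Finset (Idx N)}
    (h₁ : excitations B₁ ⊆ S) (h₂ : excitations B₂ ⊆ S) :
    ∑ᶠ x, bilinTerm f f B₁ B₂ x = ∑ x ∈ S, bilinTerm f f B₁ B₂ x := by
  refine finsum_eq_sum_of_support_subset _ fun x hx => ?_
  have hx' := support_bilinTerm_subset f f B₁ B₂ hx
  -- An index occupied in `B₁` and empty in `B₂` is a particle of `B₁` or a hole of `B₂`.
  by_cases h : 0 ≤ x.2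
  · exact h₁ (mem_excitations.2 (iff_of_true h hx'.1))
  · exact h₂ (mem_excitations.2 (iff_of_false h hx'.2))

theorem IsWick.annihilator_apply_of_subset {a : Idx N → Idx N → R} {f : Fock N R}
    (hf : IsWick a f) (z : Idx N) {B : Fin N → Maya} {S : Finset (Idx N)}
    (hS : excitations B ⊆ S) : annihilator z f B = ∑ y ∈ S, a z y * creator y f B := by
  rw [hf]
  refine Finset.sum_subset hS fun y _ hy => ?_
  rw [creator_apply_of_not (by simpa using hy), mul_zero]

theorem pairing_swap (A : Coeffs N R) (x y : Idx N) : pairing A y x = - pairing A x y := by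
  rw [pairing, pairing, neg_sub]

theorem pairing_eq_zero {A : Coeffs N R} {x y : Idx N} (h : 0 ≤ x.2 ↔ 0 ≤ y.2) :
    pairing A x y = 0 := by
  rw [pairing, coupling, coupling, if_neg (by rw [← not_le, h]; tauto),
    if_neg (by rw [← not_le, h]; tauto), sub_zero]

/-- Replacing each annihilator by its contractions leaves two double sums of products of creator
terms. After exchanging the summation indices in one of them, they cancel by antisymmetry, because
the pairing only couples particles to holes. -/
theorem IsWick.isBilinear {A : Coeffs N R} {f : Fock N R} (hf : IsWick (pairing A) f) :
    IsBilinear f := by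
  classical
  intro B₁ B₂
  set S := excitations B₁ ∪ excitations B₂
  have h₁ : excitations B₁ ⊆ S := Finset.subset_union_left
  have h₂ : excitations B₂ ⊆ S := Finset.subset_union_right
  rw [finsum_bilinTerm f h₁ h₂]
  have key : ∀ x ∈ S, bilinTerm f f B₁ B₂ x =
      (∑ y ∈ S, if 0 ≤ x.2 then pairing A x y * (creator x f B₁ * creator y f B₂) else 0) +
      ∑ y ∈ S, if 0 ≤ x.2 then 0 else pairing A x y * (creator y f B₁ * creator x f B₂) := by
    intro x _
    rw [bilinTerm_eq, hf.annihilator_apply_of_subset x h₁, hf.annihilator_apply_of_subset x h₂]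
    split_ifs
    · simp only [Finset.sum_const_zero, add_zero, Finset.mul_sum]
      exact Finset.sum_congr rfl fun y _ => by ring
    · simp only [Finset.sum_const_zero, zero_add, Finset.sum_mul]
      exact Finset.sum_congr rfl fun y _ => by ring
  rw [Finset.sum_congr rfl key, Finset.sum_add_distrib, add_comm, Finset.sum_comm,
    ← Finset.sum_add_distrib]
  refine Finset.sum_eq_zero fun x _ => ?_
  rw [← Finset.sum_add_distrib]
  refine Finset.sum_eq_zero fun y _ => ?_
  by_cases hxy : 0 ≤ x.2 ↔ 0 ≤ y.2
  · rw [pairing_eq_zero hxy, pairing_eq_zero hxy.symm]; simp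
  · by_cases hx : 0 ≤ x.2
    · rw [if_pos hx, if_neg (by tauto), pairing_swap A x y]; ring
    · rw [if_neg hx, if_pos (by tauto), add_zero]

/-- The coefficients of the Bogoliubov transform with given two-fermion coefficients. -/
def twoPoint (f : Fock N R) : Coeffs N R := fun i j m n =>
  -(sgn R (i, (m : ℤ)) (vacConf N) * annihilator (j, -(n : ℤ) - 1) f
    (toggle (i, (m : ℤ)) (vacConf N)))

/-- `twoPoint` is defined with the particle index first. If `z` is a hole index, the formula follows
by exchanging the two toggles, which costs the sign that antisymmetry requires. -/
theorem pairing_twoPoint {f : Fock N R} {z y : Idx N} (h : ¬ (0 ≤ z.2 ↔ 0 ≤ y.2)) :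
    pairing (twoPoint f) z y =
      -(sgn R z (vacConf N) * annihilator y f (toggle z (vacConf N))) := by
  classical
  have hne : z ≠ y := by rintro rfl; exact h Iff.rfl
  obtain ⟨i, r⟩ := z
  obtain ⟨j, s⟩ := y
  simp only at h
  by_cases hr : 0 ≤ r
  · have hs : s < 0 := by by_contra h'; exact h (iff_of_true hr (not_lt.1 h'))
    have h1 : ((r.toNat : ℕ) : ℤ) = r := Int.toNat_of_nonneg hr
    have h2 : -(((-s - 1).toNat : ℕ) : ℤ) - 1 = s := by omega
    rw [pairing, coupling, coupling, if_pos ⟨hr, hs⟩, if_neg (by simp only; omega), sub_zero,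
      twoPoint]
    simp only [h1, h2]
  · have hs : 0 ≤ s := by by_contra h'; exact h (iff_of_false hr h')
    have h1 : ((s.toNat : ℕ) : ℤ) = s := Int.toNat_of_nonneg hs
    have h2 : -(((-r - 1).toNat : ℕ) : ℤ) - 1 = r := by omega
    rw [pairing, coupling, coupling, if_neg (by simp only; omega), if_pos ⟨hs, not_le.1 hr⟩,
      zero_sub, twoPoint, neg_neg]
    simp only [h1, h2]
    have e1 : ¬ Excited (i, r) (toggle (j, s) (vacConf N)) := by
      rw [excited_toggle]; simp [not_excited_vacConf, hne]
    have e2 : ¬ Excited (j, s) (toggle (i, r) (vacConf N)) := by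
      rw [excited_toggle]; simp [not_excited_vacConf, Ne.symm hne]
    rw [annihilator_apply, annihilator_apply, if_neg e1, if_neg e2, ← mul_assoc, ← mul_assoc,
      sgn_mul_sgn_toggle hne, toggle_comm]
    ring

theorem creator_toggle_vacConf (f : Fock N R) [DecidableEq (Idx N)] (x z : Idx N) :
    creator x f (toggle z (vacConf N)) =
      if x = z then sgn R z (vacConf N) * f (vacConf N) else 0 := by
  classical
  rw [creator_apply]
  by_cases h : x = z
  · subst h
    have e1 : Excited x (toggle x (vacConf N)) := by
      rw [excited_toggle]; simp [not_excited_vacConf]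
    simp [e1]
  · have e1 : ¬ Excited x (toggle z (vacConf N)) := by
      rw [excited_toggle]; simp [not_excited_vacConf, h]
    simp [e1, h]

/-- The bilinear identity implies Wick's theorem. -/
theorem IsBilinear.isWick {f : Fock N R} (hf : IsBilinear f) (h1 : f (vacConf N) = 1) :
    IsWick (pairing (twoPoint f)) f := by
  classical
  intro z B
  set S := insert z (excitations B) with hS
  have hB : excitations B ⊆ S := Finset.subset_insert _ _
  have hv : excitations (toggle z (vacConf N)) ⊆ S := by
    refine excitations_toggle_subset (Finset.mem_insert_self _ _) fun x hx => ?_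
    exact absurd (mem_excitations.1 hx) (not_excited_vacConf x)
  have hz : z ∈ S := Finset.mem_insert_self _ _
  -- At a configuration whose only excitation is `z`, a creator term survives only for index `z`,
  -- where it gives the sign times the vacuum coefficient 1. This isolates `annihilator z f B` in
  -- the bilinear identity.
  have main : sgn R z (vacConf N) * annihilator z f B +
      ∑ x ∈ S, (if 0 ≤ z.2 ↔ 0 ≤ x.2 then 0 else
        annihilator x f (toggle z (vacConf N)) * creator x f B) = 0 := by
    have hsum : ∑ x ∈ S, ((if x = z then sgn R z (vacConf N) * annihilator z f B else 0) +
      (if 0 ≤ z.2 ↔ 0 ≤ x.2 then 0 else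
        annihilator x f (toggle z (vacConf N)) * creator x f B)) = 0 := by
      -- The one-excitation configuration must sit in the slot carrying the creator of index `z`:
      -- the first for a particle, the second for a hole.
      by_cases h0 : 0 ≤ z.2
      · refine Eq.trans ?_ ((finsum_bilinTerm f hv hB).symm.trans (hf _ _))
        refine Finset.sum_congr rfl fun x _ => ?_
        rw [bilinTerm_eq, creator_toggle_vacConf, h1]
        by_cases hxz : x = z
        · subst hxz; simp [h0]
        · by_cases hx : 0 ≤ x.2 <;> simp [h0, hx, hxz]
      · refine Eq.trans ?_ ((finsum_bilinTerm f hB hv).symm.trans (hf _ _))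
        refine Finset.sum_congr rfl fun x _ => ?_
        rw [bilinTerm_eq, creator_toggle_vacConf, h1]
        by_cases hxz : x = z
        · subst hxz; simp [h0, mul_comm]
        · by_cases hx : 0 ≤ x.2 <;> simp [h0, hx, hxz, mul_comm]
    rwa [Finset.sum_add_distrib, Finset.sum_ite_eq', if_pos hz] at hsum
  have h2 := congrArg (sgn R z (vacConf N) * ·) main
  simp only [mul_add, ← mul_assoc, sgn_mul_self, one_mul, mul_zero] at h2
  rw [eq_neg_of_add_eq_zero_left h2, Finset.mul_sum, ← Finset.sum_neg_distrib]
  symm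
  refine (Finset.sum_subset hB fun y _ hy => ?_).trans (Finset.sum_congr rfl fun y _ => ?_)
  · rw [creator_apply_of_not (by simpa using hy), mul_zero]
  · split_ifs with h
    · rw [pairing_eq_zero h]; simp
    · rw [pairing_twoPoint h]; ring

theorem IsBilinear.isBogoliubov [Algebra ℚ R] {f : Fock N R} (hf : IsBilinear f)
    (h1 : f (vacConf N) = 1) : IsBogoliubov f :=
  ⟨twoPoint f, (hf.isWick h1).ext (isWick_bogoliubov _) (h1.trans (bogoliubov_vacConf _).symm)⟩

theorem isBilinear_bogoliubov [Algebra ℚ R] (A : Coeffs N R) : IsBilinear (bogoliubov A) :=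
  (isWick_bogoliubov A).isBilinear

end

/-! ### Splitting the components and contracting over one group. -/

section

variable {M K N : ℕ} {R : Type*} [CommRing R]

/-- The index in the first `M` of `M + K` components. -/
def leftIdx (K : ℕ) (x : Idx M) : Idx (M + K) := (Fin.castAdd K x.1, x.2)

/-- The index in the last `K` of `M + K` components. -/
def rightIdx (M : ℕ) (y : Idx K) : Idx (M + K) := (Fin.natAdd M y.1, y.2)

theorem idx_cases {motive : Idx (M + K) → Prop} (left : ∀ x, motive (leftIdx K x))
    (right : ∀ y, motive (rightIdx M y)) (z : Idx (M + K)) : motive z := by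
  obtain ⟨i, r⟩ := z
  induction i using Fin.addCases with
  | left i => exact left (i, r)
  | right i => exact right (i, r)

theorem leftIdx_injective : Function.Injective (leftIdx (M := M) K) := fun x y h => by
  simp only [leftIdx, Prod.mk.injEq, Fin.castAdd_inj] at h
  exact Prod.ext h.1 h.2

theorem rightIdx_injective : Function.Injective (rightIdx (K := K) M) := fun x y h => by
  simp only [rightIdx, Prod.mk.injEq, Fin.natAdd_inj] at h
  exact Prod.ext h.1 h.2

theorem leftIdx_ne_rightIdx (x : Idx M) (y : Idx K) : leftIdx K x ≠ rightIdx M y := fun h => by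
  have := congrArg (fun z => (z.1 : ℕ)) h
  simp only [leftIdx, rightIdx, Fin.val_castAdd, Fin.val_natAdd] at this
  have := x.1.2
  omega

@[simp] theorem occ_leftIdx {x : Idx M} {C : Fin M → Maya} {B : Fin K → Maya} :
    Occ (leftIdx K x) (Fin.append C B) ↔ Occ x C := by
  simp [Occ, leftIdx]

@[simp] theorem occ_rightIdx {y : Idx K} {C : Fin M → Maya} {B : Fin K → Maya} :
    Occ (rightIdx M y) (Fin.append C B) ↔ Occ y B := by
  simp [Occ, rightIdx]

theorem toggle_leftIdx (x : Idx M) (C : Fin M → Maya) (B : Fin K → Maya) :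
    toggle (leftIdx K x) (Fin.append C B) = Fin.append (toggle x C) B :=
  conf_ext (idx_cases (fun z => by simp [occ_toggle, leftIdx_injective.eq_iff])
    (fun z => by simp [occ_toggle, (leftIdx_ne_rightIdx _ _).symm]))

theorem toggle_rightIdx (y : Idx K) (C : Fin M → Maya) (B : Fin K → Maya) :
    toggle (rightIdx M y) (Fin.append C B) = Fin.append C (toggle y B) :=
  conf_ext (idx_cases (fun z => by simp [occ_toggle, leftIdx_ne_rightIdx])
    (fun z => by simp [occ_toggle, rightIdx_injective.eq_iff]))

/-- The Koszul sign of moving a fermion past all components of `C`. -/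
def chargeSign (R : Type*) [CommRing R] (C : Fin M → Maya) : R :=
  ((Int.negOnePow (∑ i, (C i).charge) : ℤˣ) : ℤ)

theorem chargeSign_vacConf : chargeSign R (vacConf M) = 1 := by
  simp [chargeSign, vacConf, Maya.charge_vacuum]

theorem sgn_leftIdx (x : Idx M) (C : Fin M → Maya) (B : Fin K → Maya) :
    sgn R (leftIdx K x) (Fin.append C B) = sgn R x C := by
  have h : ∑ j ∈ Finset.univ.filter (· < Fin.castAdd K x.1), (Fin.append C B j).charge
      = ∑ j ∈ Finset.univ.filter (· < x.1), (C j).charge := by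
    rw [Finset.sum_filter, Finset.sum_filter, Fin.sum_univ_add]
    have h1 : ∀ j : Fin K, ¬ (Fin.natAdd M j < Fin.castAdd K x.1) := fun j => by
      simp only [Fin.lt_def, Fin.val_natAdd, Fin.val_castAdd]
      have := x.1.2
      omega
    have h2 : ∀ j : Fin M, Fin.castAdd K j < Fin.castAdd K x.1 ↔ j < x.1 := fun j => Iff.rfl
    simp [h1, h2]
  change ((((∑ j ∈ Finset.univ.filter (· < Fin.castAdd K x.1), (Fin.append C B j).charge) +
    ((Fin.append C B (Fin.castAdd K x.1)).above x.2 : ℤ)).negOnePow : ℤ) : R) = _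
  rw [h, Fin.append_left]
  rfl

theorem sgn_rightIdx (y : Idx K) (C : Fin M → Maya) (B : Fin K → Maya) :
    sgn R (rightIdx M y) (Fin.append C B) = chargeSign R C * sgn R y B := by
  have h : ∑ j ∈ Finset.univ.filter (· < Fin.natAdd M y.1), (Fin.append C B j).charge
      = ∑ j, (C j).charge + ∑ j ∈ Finset.univ.filter (· < y.1), (B j).charge := by
    rw [Finset.sum_filter, Finset.sum_filter, Fin.sum_univ_add]
    have h1 : ∀ j : Fin M, Fin.castAdd K j < Fin.natAdd M y.1 := fun j => by
      simp only [Fin.lt_def, Fin.val_natAdd, Fin.val_castAdd]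
      have := j.2
      omega
    simp [h1]
  change ((((∑ j ∈ Finset.univ.filter (· < Fin.natAdd M y.1), (Fin.append C B j).charge) +
    ((Fin.append C B (Fin.natAdd M y.1)).above y.2 : ℤ)).negOnePow : ℤ) : R) = _
  rw [h, Fin.append_right, add_assoc, Int.negOnePow_add, Units.val_mul, Int.cast_mul]
  rfl

theorem finsum_idx_add {g : Idx (M + K) → R} (hg : (Function.support g).Finite) :
    ∑ᶠ z, g z = ∑ᶠ x, g (leftIdx K x) + ∑ᶠ y, g (rightIdx M y) := by
  rw [← finsum_mem_range leftIdx_injective, ← finsum_mem_range rightIdx_injective,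
    ← finsum_mem_union' _ (hg.subset Set.inter_subset_right) (hg.subset Set.inter_subset_right),
    ← finsum_mem_univ g]
  · congr 1
    funext z
    have : z ∈ Set.range (leftIdx K) ∪ Set.range (rightIdx M) :=
      idx_cases (motive := fun z => z ∈ Set.range (leftIdx K) ∪ Set.range (rightIdx M))
        (fun x => Or.inl ⟨x, rfl⟩) (fun y => Or.inr ⟨y, rfl⟩) z
    simp only [this, Set.mem_univ]
  · rw [Set.disjoint_left]
    rintro _ ⟨x, rfl⟩ ⟨y, hy⟩
    exact leftIdx_ne_rightIdx x y hy.symm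

theorem finite_support_bilinTerm (f g : Fock N R) (B₁ B₂ : Fin N → Maya) :
    (Function.support (bilinTerm f g B₁ B₂)).Finite :=
  (finite_occ_diff B₁ B₂).subset (support_bilinTerm_subset f g B₁ B₂)

/-- The bilinear form splits into the contributions of the two groups of components. -/
theorem finsum_bilinTerm_append (v : Fock (M + K) R) (C₁ C₂ : Fin M → Maya)
    (B₁ B₂ : Fin K → Maya) :
    ∑ᶠ z, bilinTerm v v (Fin.append C₁ B₁) (Fin.append C₂ B₂) z =
      ∑ᶠ x, bilinTerm (fun C => v (Fin.append C B₁)) (fun C => v (Fin.append C B₂)) C₁ C₂ x +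
      chargeSign R C₁ * chargeSign R C₂ *
        ∑ᶠ y, bilinTerm (fun B => v (Fin.append C₁ B)) (fun B => v (Fin.append C₂ B)) B₁ B₂ y := by
  rw [finsum_idx_add (finite_support_bilinTerm _ _ _ _),
    mul_finsum' _ _ (finite_support_bilinTerm _ _ _ _)]
  congr 1
  · refine finsum_congr fun x => ?_
    rw [bilinTerm, bilinTerm]
    by_cases h : Occ x C₁ ∧ ¬ Occ x C₂
    · rw [if_pos h, if_pos (by simpa using h)]
      simp only [toggle_leftIdx, sgn_leftIdx]
    · rw [if_neg h, if_neg (by simpa using h)]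
  · refine finsum_congr fun y => ?_
    rw [bilinTerm, bilinTerm]
    by_cases h : Occ y B₁ ∧ ¬ Occ y B₂
    · rw [if_pos h, if_pos (by simpa using h)]
      simp only [toggle_rightIdx, sgn_rightIdx]
      ring
    · rw [if_neg h, if_neg (by simpa using h), mul_zero]

/-- With respect to the inner product, the two tensor factors of Hirota's bilinear form are
adjoint to each other. -/
theorem finsum_bilinTerm_adjoint (f g p : Fock N R) (hp : (Function.support p).Finite) :
    ∑ᶠ q : (Fin N → Maya) × (Fin N → Maya), p q.1 * p q.2 * ∑ᶠ y, bilinTerm f g q.1 q.2 y =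
      ∑ᶠ q : (Fin N → Maya) × (Fin N → Maya), f q.1 * g q.2 * ∑ᶠ y, bilinTerm p p q.2 q.1 y := by
  classical
  set H : ((Fin N → Maya) × (Fin N → Maya)) × Idx N → R :=
    fun t => p t.1.1 * p t.1.2 * bilinTerm f g t.1.1 t.1.2 t.2 with hH
  -- Toggling the same index in both configurations is an involution that preserves its signs. It
  -- exchanges occupied and empty, so the two arguments of the second bilinear form appear in
  -- reversed order.
  set e : ((Fin N → Maya) × (Fin N → Maya)) × Idx N ≃ ((Fin N → Maya) × (Fin N → Maya)) × Idx N :=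
    ⟨fun t => ((toggle t.2 t.1.1, toggle t.2 t.1.2), t.2),
      fun t => ((toggle t.2 t.1.1, toggle t.2 t.1.2), t.2), fun t => by simp, fun t => by simp⟩
    with he
  have hfin : (Function.support H).Finite := by
    refine ((hp.prod hp).biUnion fun q _ =>
      (finite_occ_diff q.1 q.2).image (Prod.mk q)).subset fun t ht => ?_
    have h1 := left_ne_zero_of_mul (show H t ≠ 0 from ht)
    refine Set.mem_biUnion (x := t.1) ⟨left_ne_zero_of_mul h1, right_ne_zero_of_mul h1⟩
      ⟨t.2, support_bilinTerm_subset f g _ _ (right_ne_zero_of_mul (show H t ≠ 0 from ht)), rfl⟩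
  have hHe : ∀ t, H (e t) = f t.1.1 * g t.1.2 * bilinTerm p p t.1.2 t.1.1 t.2 := by
    intro t
    simp only [hH, he, Equiv.coe_fn_mk, bilinTerm, occ_toggle, ne_eq, not_true_eq_false, iff_false,
      not_not, sgn_toggle_self, toggle_toggle]
    by_cases h1 : Occ t.2 t.1.1 <;> by_cases h2 : Occ t.2 t.1.2 <;> simp [h1, h2]
    ring
  have hfin' : (Function.support fun t => H (e t)).Finite :=
    hfin.preimage e.injective.injOn
  have h1 : ∑ᶠ t, H t = ∑ᶠ q : (Fin N → Maya) × (Fin N → Maya),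
      p q.1 * p q.2 * ∑ᶠ y, bilinTerm f g q.1 q.2 y := by
    rw [finsum_curry _ hfin]
    refine finsum_congr fun q => ?_
    rw [mul_finsum' _ _ (finite_support_bilinTerm _ _ _ _)]
  have h2 : ∑ᶠ t, H (e t) = ∑ᶠ q : (Fin N → Maya) × (Fin N → Maya),
      f q.1 * g q.2 * ∑ᶠ y, bilinTerm p p q.2 q.1 y := by
    rw [finsum_curry _ hfin']
    refine finsum_congr fun q => ?_
    rw [mul_finsum' _ _ (finite_support_bilinTerm _ _ _ _)]
    exact finsum_congr fun y => hHe (q, y)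
  rw [← h1, ← h2, finsum_comp_equiv]

/-- The contraction of two solutions of the bilinear identity is a solution. -/
theorem IsBilinear.contract {v : Fock (M + K) R} {p : Fock K R} (hv : IsBilinear v)
    (hp : IsBilinear p) (hfin : (Function.support p).Finite) :
    IsBilinear fun C : Fin M → Maya => ∑ᶠ B, v (Fin.append C B) * p B := by
  classical
  intro C₁ C₂
  set T := hfin.toFinset with hT
  have hg : ∀ C : Fin M → Maya, ∑ᶠ B, v (Fin.append C B) * p B =
      ∑ B ∈ T, v (Fin.append C B) * p B := fun C =>
    finsum_eq_sum_of_support_subset _ fun B hB => by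
      simpa [hT] using right_ne_zero_of_mul (show v (Fin.append C B) * p B ≠ 0 from hB)
  set X := (finite_occ_diff C₁ C₂).toFinset with hX
  have hXs : ∀ f g : Fock M R, ∑ᶠ x, bilinTerm f g C₁ C₂ x = ∑ x ∈ X, bilinTerm f g C₁ C₂ x :=
    fun f g => finsum_eq_sum_of_support_subset _ (by
      simpa [hX] using support_bilinTerm_subset f g C₁ C₂)
  have hterm : ∀ x, bilinTerm (fun C => ∑ᶠ B, v (Fin.append C B) * p B)
      (fun C => ∑ᶠ B, v (Fin.append C B) * p B) C₁ C₂ x =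
      ∑ q ∈ T ×ˢ T, p q.1 * p q.2 * bilinTerm (fun C => v (Fin.append C q.1))
        (fun C => v (Fin.append C q.2)) C₁ C₂ x := by
    intro x
    simp only [bilinTerm, hg]
    split_ifs
    · rw [Finset.sum_mul_sum, ← Finset.sum_product', Finset.mul_sum]
      exact Finset.sum_congr rfl fun q _ => by ring
    · simp
  rw [hXs, Finset.sum_congr rfl fun x _ => hterm x, Finset.sum_comm]
  have hq : ∀ q ∈ T ×ˢ T, ∑ x ∈ X, p q.1 * p q.2 * bilinTerm (fun C => v (Fin.append C q.1))
        (fun C => v (Fin.append C q.2)) C₁ C₂ x =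
      -(chargeSign R C₁ * chargeSign R C₂) * (p q.1 * p q.2 *
        ∑ᶠ y, bilinTerm (fun B => v (Fin.append C₁ B)) (fun B => v (Fin.append C₂ B))
          q.1 q.2 y) := by
    intro q _
    -- The identity for `v` trades the sum over the first components for minus the sum over the last
    -- ones. The Koszul factor depends only on `C₁` and `C₂`, hence leaves the sum over `q`.
    have h := hv (Fin.append C₁ q.1) (Fin.append C₂ q.2)
    rw [finsum_bilinTerm_append, hXs] at h
    rw [← Finset.mul_sum, eq_neg_of_add_eq_zero_left h]
    ring
  rw [Finset.sum_congr rfl hq, ← Finset.mul_sum, ← finsum_eq_sum_of_support_subset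
    (fun q : (Fin K → Maya) × (Fin K → Maya) => p q.1 * p q.2 *
      ∑ᶠ y, bilinTerm (fun B => v (Fin.append C₁ B)) (fun B => v (Fin.append C₂ B)) q.1 q.2 y),
    finsum_bilinTerm_adjoint _ _ _ hfin]
  · have h0 : ∀ q : (Fin K → Maya) × (Fin K → Maya), ∑ᶠ y, bilinTerm p p q.2 q.1 y = 0 :=
      fun q => hp _ _
    simp [h0]
  · intro q hq
    have h1 := left_ne_zero_of_mul (Function.mem_support.1 hq)
    simpa [hT] using ⟨left_ne_zero_of_mul h1, right_ne_zero_of_mul h1⟩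

theorem map_finsum_bilinTerm {S : Type*} [CommRing S] (φ : R →+* S) (f : Fock N R)
    (B₁ B₂ : Fin N → Maya) : φ (∑ᶠ x, bilinTerm f f B₁ B₂ x) =
      ∑ᶠ x, bilinTerm (fun B => φ (f B)) (fun B => φ (f B)) B₁ B₂ x := by
  have h := φ.toAddMonoidHom.map_finsum (finite_support_bilinTerm f f B₁ B₂)
  refine h.trans (finsum_congr fun x => ?_)
  simp only [bilinTerm, RingHom.toAddMonoidHom_eq_coe, AddMonoidHom.coe_coe]
  split_ifs <;> simp [map_sgn]

theorem IsBilinear.map {S : Type*} [CommRing S] (φ : R →+* S) {f : Fock N R}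
    (hf : IsBilinear f) : IsBilinear fun B => φ (f B) := fun B₁ B₂ => by
  rw [← map_finsum_bilinTerm, hf, map_zero]

theorem IsBilinear.smul {f : Fock N R} (hf : IsBilinear f) (c : R) : IsBilinear (c • f) :=
  fun B₁ B₂ => by
    have h : ∀ x, bilinTerm (c • f) (c • f) B₁ B₂ x = c * c * bilinTerm f f B₁ B₂ x := fun x => by
      simp only [bilinTerm, Pi.smul_apply, smul_eq_mul]
      split_ifs
      · ring
      · rw [mul_zero]
    rw [finsum_congr h, ← mul_finsum' _ _ (finite_support_bilinTerm _ _ _ _), hf, mul_zero]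

/-- Restricting a Bogoliubov transform to the vacuum in the first components gives the Bogoliubov
transform with the restricted coefficients. -/
theorem bogoliubov_append_vacConf [Algebra ℚ R] (A : Coeffs (M + K) R) (B : Fin K → Maya) :
    bogoliubov A (Fin.append (vacConf M) B) =
      bogoliubov (fun i j => A (Fin.natAdd M i) (Fin.natAdd M j)) B := by
  classical
  have hexc : ∀ (y : Idx K) (B : Fin K → Maya),
      Excited (rightIdx M y) (Fin.append (vacConf M) B) ↔ Excited y B := fun y B => by
    simp [Excited, rightIdx, Occ]
  have hleft : ∀ (x : Idx M) (B : Fin K → Maya),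
      ¬ Excited (leftIdx K x) (Fin.append (vacConf M) B) := fun x B => by
    have := not_excited_vacConf x
    simpa [Excited, leftIdx, Occ] using this
  -- With the vacuum in the first components no excitation lies there, so Wick's recursion at a
  -- right index involves right indices only. Uniqueness then identifies the restriction.
  suffices H : IsWick (pairing fun i j => A (Fin.natAdd M i) (Fin.natAdd M j))
      (fun B => bogoliubov A (Fin.append (vacConf M) B)) by
    refine congrFun (H.ext (isWick_bogoliubov _) ?_) B
    rw [bogoliubov_vacConf, ← bogoliubov_vacConf A]
    congr 1
    exact conf_ext (idx_cases (fun x => by rw [occ_leftIdx]; rfl)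
      (fun y => by rw [occ_rightIdx]; rfl))
  intro z B
  have h := isWick_bogoliubov A (rightIdx M z) (Fin.append (vacConf M) B)
  have hex : excitations (Fin.append (vacConf M) B) =
      (excitations B).map ⟨rightIdx M, rightIdx_injective⟩ := by
    ext w
    refine idx_cases (motive := fun w => w ∈ excitations (Fin.append (vacConf M) B) ↔
      w ∈ (excitations B).map ⟨rightIdx M, rightIdx_injective⟩) (fun x => ?_) (fun y => ?_) w
    · simp [hleft, (leftIdx_ne_rightIdx _ _).symm]
    · simp [hexc]
  rw [hex, Finset.sum_map] at h
  simp only [Function.Embedding.coeFn_mk, annihilator_apply, creator_apply, hexc, toggle_rightIdx,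
    sgn_rightIdx, chargeSign_vacConf, one_mul] at h
  simp only [annihilator_apply, creator_apply]
  exact h

end

/-! ### Convergence in `Q` and the normalized self-gluing. -/

section

variable {M N : ℕ} {R : Type*} [CommRing R]

/-- The distance of a half-integer from the Fermi level. -/
def level (z : Idx N) : ℕ := if 0 ≤ z.2 then z.2.toNat else (-z.2 - 1).toNat

/-- The exponent `m + n + 1` is at least `m + 1` and at least `n + 1`, so either end of the pair
alone bounds the order in `q`. -/
theorem dvd_pairing {S : Type*} [CommRing S] {q : S} {A : Coeffs N S}
    (hA : ∀ i j m n, q ^ (m + n + 1) ∣ A i j m n) (z y : Idx N) :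
    q ^ (level z + 1) ∣ pairing A z y := by
  have h : ∀ x y : Idx N, q ^ (level x + 1) ∣ coupling A x y ∧
      q ^ (level y + 1) ∣ coupling A x y := by
    intro x y
    rw [coupling]
    split_ifs with h
    · rw [level, level, if_pos h.1, if_neg (not_le.2 h.2)]
      exact ⟨(pow_dvd_pow q (by omega)).trans (hA _ _ _ _),
        (pow_dvd_pow q (by omega)).trans (hA _ _ _ _)⟩
    · exact ⟨dvd_zero _, dvd_zero _⟩
  exact dvd_sub (h z y).1 (h y z).2

/-- Wick's recursion at `toggle z B` writes the coefficient at `B` as a sum of terms each containing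
a pairing with `z`. -/
theorem IsWick.dvd_apply {S : Type*} [CommRing S] {q : S} {A : Coeffs N S}
    (hA : ∀ i j m n, q ^ (m + n + 1) ∣ A i j m n) {f : Fock N S} (hf : IsWick (pairing A) f)
    {z : Idx N} {B : Fin N → Maya} (hz : Excited z B) : q ^ (level z + 1) ∣ f B := by
  classical
  have hz' : ¬ Excited z (toggle z B) := by simp [excited_toggle, hz]
  have h := hf z (toggle z B)
  rw [annihilator_apply, if_neg hz', toggle_toggle] at h
  have h2 := congrArg (sgn S z (toggle z B) * ·) h
  simp only [← mul_assoc, sgn_mul_self, one_mul] at h2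
  rw [h2]
  exact Dvd.dvd.mul_left (Finset.dvd_sum fun y _ => Dvd.dvd.mul_right (dvd_pairing hA z y) _) _

variable [Algebra ℚ R]

theorem isWick_gluingVector (E : Coeffs 2 R) : IsWick (pairing fun i j m n =>
    (PowerSeries.X : Series R) ^ (m + n + 1) *
      PowerSeries.C (LaurentPolynomial.T (R := R) (thetaExp i j)) * const R (E i j m n))
    (gluingVector E) :=
  isWick_bogoliubov _

theorem X_pow_dvd_gluingVector (E : Coeffs 2 R) {z : Idx 2} {B : Fin 2 → Maya}
    (hz : Excited z B) : (PowerSeries.X : Series R) ^ (level z + 1) ∣ gluingVector E B :=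
  (isWick_gluingVector E).dvd_apply (fun i j m n => by
    rw [mul_assoc]; exact Dvd.intro _ rfl) hz

/-- All excitations of such a configuration have bounded level, and a finite set of indices has
finitely many subsets. This is the source of all convergence. -/
theorem finite_not_dvd_gluingVector (E : Coeffs 2 R) (d : ℕ) :
    {B | ¬ (PowerSeries.X : Series R) ^ d ∣ gluingVector E B}.Finite := by
  refine Set.Finite.subset ((Finset.finite_toSet
    (Finset.univ ×ˢ Finset.Icc (-(d : ℤ)) d : Finset (Idx 2)).powerset).preimage
      excitations_injective.injOn) fun B hB => ?_
  simp only [Set.mem_preimage, Finset.mem_coe, Finset.mem_powerset]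
  intro z hz
  have h : level z + 1 < d := by
    by_contra h
    exact hB ((pow_dvd_pow _ (not_lt.1 h)).trans
      (X_pow_dvd_gluingVector E (mem_excitations.1 hz)))
  simp only [Finset.mem_product, Finset.mem_univ, Finset.mem_Icc, true_and]
  rw [level] at h
  split_ifs at h <;> omega

theorem not_dvd_of_coeff_ne_zero {E : Coeffs 2 R} {v : Fock 2 (Series R)} {n d : ℕ} (hn : n < d)
    {B : Fin 2 → Maya} (h : PowerSeries.coeff n (v B * gluingVector E B) ≠ 0) :
    ¬ (PowerSeries.X : Series R) ^ d ∣ gluingVector E B := fun h' =>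
  h (PowerSeries.X_pow_dvd_iff.1 (Dvd.dvd.mul_left h' _) n hn)

theorem innerConverges_gluingVector (v : Fock 2 (Series R)) (E : Coeffs 2 R) :
    InnerConverges v (gluingVector E) := fun d =>
  (finite_not_dvd_gluingVector E (d + 1)).subset fun _ hB =>
    not_dvd_of_coeff_ne_zero d.lt_succ_self hB

/-- The inner product with the gluing vector is a finite sum modulo each power of `Q`. -/
theorem mk_inner_gluingVector (v : Fock 2 (Series R)) (E : Coeffs 2 R) (d : ℕ) :
    Ideal.Quotient.mk (Ideal.span {(PowerSeries.X : Series R) ^ d}) (inner v (gluingVector E)) =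
      ∑ᶠ B, Ideal.Quotient.mk (Ideal.span {(PowerSeries.X : Series R) ^ d}) (v B) *
        Ideal.Quotient.mk (Ideal.span {(PowerSeries.X : Series R) ^ d}) (gluingVector E B) := by
  set T := (finite_not_dvd_gluingVector E d).toFinset with hT
  rw [finsum_eq_sum_of_support_subset (s := T)]
  · simp only [← map_mul, ← map_sum]
    rw [Ideal.Quotient.eq, Ideal.mem_span_singleton, PowerSeries.X_pow_dvd_iff]
    intro n hn
    rw [map_sub, map_sum, sub_eq_zero, inner, PowerSeries.coeff_mk]
    refine finsum_eq_sum_of_support_subset _ fun B hB => ?_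
    simpa [hT] using not_dvd_of_coeff_ne_zero hn hB
  · intro B hB
    have h := right_ne_zero_of_mul (Function.mem_support.1 hB)
    rw [Ne, Ideal.Quotient.eq_zero_iff_mem, Ideal.mem_span_singleton] at h
    simpa [hT] using h

theorem isBilinear_selfGluing (A : Coeffs (M + 2) R) (E : Coeffs 2 R) :
    IsBilinear (selfGluing (bogoliubov A) E) := by
  intro C₁ C₂
  -- A power series divisible by every power of `Q` is zero. In each quotient the gluing vector has
  -- finite support, so `IsBilinear.contract` applies.
  suffices H : ∀ d, (PowerSeries.X : Series R) ^ d ∣ ∑ᶠ x, bilinTerm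
      (selfGluing (bogoliubov A) E) (selfGluing (bogoliubov A) E) C₁ C₂ x by
    ext1 n
    rw [map_zero]
    exact PowerSeries.X_pow_dvd_iff.1 (H (n + 1)) n n.lt_succ_self
  intro d
  rw [← Ideal.mem_span_singleton, ← Ideal.Quotient.eq_zero_iff_mem, map_finsum_bilinTerm]
  have h := IsBilinear.contract
    (((isBilinear_bogoliubov A).map (const R)).map
      (Ideal.Quotient.mk (Ideal.span {(PowerSeries.X : Series R) ^ d})))
    ((isWick_gluingVector E).isBilinear.map
      (Ideal.Quotient.mk (Ideal.span {(PowerSeries.X : Series R) ^ d})))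
    ((finite_not_dvd_gluingVector E d).subset fun B hB => by
      rwa [Function.mem_support, Ne, Ideal.Quotient.eq_zero_iff_mem,
        Ideal.mem_span_singleton] at hB)
  simp only [selfGluing, mk_inner_gluingVector]
  exact h C₁ C₂

theorem selfGluing_vacConf (A : Coeffs (M + 2) R) (E : Coeffs 2 R) :
    selfGluing (bogoliubov A) E (vacConf M) = closedPart A E := by
  rw [selfGluing, closedPart]
  congr 1
  funext B
  simp only [slice, extend, closedVector, bogoliubov_append_vacConf]

/-- Every configuration with an excitation contributes a multiple of `Q`, and the vacuum contributes
1. -/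
theorem isUnit_closedPart (A : Coeffs (M + 2) R) (E : Coeffs 2 R) : IsUnit (closedPart A E) := by
  rw [PowerSeries.isUnit_iff_constantCoeff]
  have h : PowerSeries.constantCoeff (closedPart A E) = 1 := by
    rw [← PowerSeries.coeff_zero_eq_constantCoeff_apply, closedPart, inner, PowerSeries.coeff_mk,
      finsum_eq_single _ (vacConf 2)]
    · simp [extend, closedVector, gluingVector, bogoliubov_vacConf]
    · intro B hB
      obtain ⟨z, hz⟩ : ∃ z, Excited z B := by
        by_contra h
        exact hB (eq_vacConf (not_exists.1 h))
      by_contra hne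
      exact not_dvd_of_coeff_ne_zero (Nat.succ_pos (level z)) hne (X_pow_dvd_gluingVector E hz)
  rw [h]
  exact isUnit_one

theorem isBogoliubov_normalizedSelfGluing (A : Coeffs (M + 2) R) (E : Coeffs 2 R) :
    IsBogoliubov (normalizedSelfGluing A E) := by
  refine ((isBilinear_selfGluing A E).smul _).isBogoliubov ?_
  rw [Pi.smul_apply, selfGluing_vacConf, smul_eq_mul,
    Ring.inverse_mul_cancel _ (isUnit_closedPart A E)]

end

end FermionicGluing

end

theorem mainTheorem2 {R : Type*} [CommRing R] [Algebra ℚ R] (M : ℕ) (hM : 0 < M)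
    (A : FermionicGluing.Coeffs (M + 2) R) (E : FermionicGluing.Coeffs 2 R) :
    (∀ C : Fin M → FermionicGluing.Maya,
      FermionicGluing.InnerConverges
        (FermionicGluing.slice (FermionicGluing.extend (FermionicGluing.bogoliubov A)) C)
        (FermionicGluing.gluingVector E)) ∧
    FermionicGluing.InnerConverges
      (FermionicGluing.extend (FermionicGluing.closedVector A))
      (FermionicGluing.gluingVector E) ∧
    IsUnit (FermionicGluing.closedPart A E) ∧
    FermionicGluing.IsBogoliubov (FermionicGluing.normalizedSelfGluing A E) := by
  exact ⟨fun _ => FermionicGluing.innerConverges_gluingVector _ E,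
    FermionicGluing.innerConverges_gluingVector _ E,
    FermionicGluing.isUnit_closedPart A E,
    FermionicGluing.isBogoliubov_normalizedSelfGluing A E⟩
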